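/- Theorem 2.1 (Comparison Theorem). Let $H:\mathbb R^n\to\mathbb R$ be convex with $H(0)=\min_{\mathbb R^n} H=0$, and suppose that the set $\{p: H(p)=0\}$ is bounded and has empty interior. Let $U\subset\mathbb R^n$ be bounded and open. For open sets $V$ and $U$, write $V\ll U$ if $\overline V$ is a compact subset of $U$; let $\mathrm{Lip}_{\mathrm{loc}}(U)$ be the set of functions $u:U\to\mathbb R$ that are Lipschitz continuous on every open $V\ll U$; and for $v\in\mathrm{Lip}_{\mathrm{loc}}(V)$ (which is differentiable almost everywhere in $V$) put $\|H(Dv)\|_{L^\infty(V)}:=\operatorname{ess\,sup}_{x\in V}H(Dv(x))\le\infty$. A function $u\in\mathrm{Lip}_{\mathrm{loc}}(U)$ is *absolutely minimizing for $H$ in $U$* if $$\|H(Du)\|_{L^\infty(V)}\le\|H(Dv)\|_{L^\infty(V)}$$ whenever $V\ll U$ is open and $v\in\mathrm{Lip}_{\mathrm{loc}}(V)\cap C(\overline V)$ satisfies $v=u$ on $\partial V$. It is *absolutely subminimizing* (respectively, *absolutely superminimizing*) *for $H$ in $U$* if this inequality holds for all such $V$ and $v$ that satisfy in addition $v\le u$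 in $V$ (respectively, $v\ge u$ in $V$). (a) If $u,v\in C(\overline U)$, $u$ is absolutely subminimizing for $H$ in $U$ and $v$ is absolutely superminimizing for $H$ in $U$, then $$u(x)-v(x)\le\max_{y\in\partial U}\bigl(u(y)-v(y)\bigr)\qquad\text{for every }x\in U.$$ (b) Consequently, absolutely minimizing functions are uniquely determined by their boundary values: if $u,v\in C(\overline U)$ are both absolutely minimizing for $H$ in $U$ and $u=v$ on $\partial U$, then $u=v$ on $\overline U$. -/

import Mathlib

open MeasureTheory Set

noncomputable section

/-- `V ≪ U` for open sets: the closure of `V` is a compact subset of `U`. -/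
def CompactlyInside {n : ℕ} (V U : Set (EuclideanSpace ℝ (Fin n))) : Prop :=
  IsOpen V ∧ IsCompact (closure V) ∧ closure V ⊆ U

/-- `u ∈ Lip_loc(U)`: `u` is Lipschitz continuous on every open `V ≪ U`.
Only the values of `u` on `U` matter. -/
def LipLoc {n : ℕ} (U : Set (EuclideanSpace ℝ (Fin n)))
    (u : EuclideanSpace ℝ (Fin n) → ℝ) : Prop :=
  ∀ V : Set (EuclideanSpace ℝ (Fin n)), CompactlyInside V U →
    ∃ K : NNReal, LipschitzOnWith K u V

/-- `‖H(Du)‖_{L^∞(V)} = ess sup_{x ∈ V} H(Du(x))`, possibly `+∞`.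
It is used only for `V` open and `u ∈ Lip_loc(V)`: then `u` is differentiable at almost every
point of `V`, and at a point of `V` the gradient depends only on `u` near that point. -/
def supH {n : ℕ} (H : EuclideanSpace ℝ (Fin n) → ℝ) (V : Set (EuclideanSpace ℝ (Fin n)))
    (u : EuclideanSpace ℝ (Fin n) → ℝ) : EReal :=
  essSup (fun x => ((H (gradient u x) : ℝ) : EReal)) (volume.restrict V)

/-- `v` competes with `u` on `V`: `v ∈ Lip_loc(V) ∩ C(closure V)` and `v = u` on `∂V`. -/
def Competitor {n : ℕ} (V : Set (EuclideanSpace ℝ (Fin n)))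
    (u v : EuclideanSpace ℝ (Fin n) → ℝ) : Prop :=
  LipLoc V v ∧ ContinuousOn v (closure V) ∧ EqOn v u (frontier V)

/-- `u` is absolutely minimizing for `H` in `U`. -/
def AbsMinimizing {n : ℕ} (H : EuclideanSpace ℝ (Fin n) → ℝ)
    (U : Set (EuclideanSpace ℝ (Fin n))) (u : EuclideanSpace ℝ (Fin n) → ℝ) : Prop :=
  LipLoc U u ∧ ∀ V, CompactlyInside V U → ∀ v, Competitor V u v → supH H V u ≤ supH H V v

/-- `u` is absolutely subminimizing for `H` in `U`: only competitors `v ≤ u` are considered. -/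
def AbsSubminimizing {n : ℕ} (H : EuclideanSpace ℝ (Fin n) → ℝ)
    (U : Set (EuclideanSpace ℝ (Fin n))) (u : EuclideanSpace ℝ (Fin n) → ℝ) : Prop :=
  LipLoc U u ∧ ∀ V, CompactlyInside V U → ∀ v, Competitor V u v →
    (∀ x ∈ V, v x ≤ u x) → supH H V u ≤ supH H V v

/-- `u` is absolutely superminimizing for `H` in `U`: only competitors `v ≥ u` are considered. -/
def AbsSuperminimizing {n : ℕ} (H : EuclideanSpace ℝ (Fin n) → ℝ)
    (U : Set (EuclideanSpace ℝ (Fin n))) (u : EuclideanSpace ℝ (Fin n) → ℝ) : Prop :=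
  LipLoc U u ∧ ∀ V, CompactlyInside V U → ∀ v, Competitor V u v →
    (∀ x ∈ V, u x ≤ v x) → supH H V u ≤ supH H V v

end

/-!
An absolutely subminimizing `u` satisfies comparison with the generalized cones of `H` from above:
where `u` lies strictly above such a cone, the cone is a competitor, so the gradient of `u` is as
small as that of the cone, and following a ray to the vertex shows that `u` cannot lie above it.
Comparison with cones in turn makes the sup-convolution of `u` with the Lagrangian cost of a short
time `t` a discrete subsolution: its largest gain in a short move is at least its largest loss. The
same holds for `-v` and `p ↦ H (-p)`.

Two discrete subsolutions obey a maximum principle as soon as one of them has gain bounded away from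
zero: near a maximum of the sum one could otherwise climb forever. This is arranged by lowering one
of them a little on the set where its gain is small. The empty interior of `{H = 0}` enters here: it
provides a direction orthogonal to the zeros of `H`, in which short moves are so cheap that the
boundary is reached at negligible total cost.
-/

noncomputable section

open Bornology Filter Metric Topology

section DiscreteComparison

variable {X : Type*} {N : X → X → Prop} {c : X → X → ℝ} {D : Set X} {f g w : X → ℝ} {γ : ℝ}

/-- The largest net gain `f y - f x - c x y` of a move from `x` to a neighbour `y`; the relation `N`
says which points are neighbours and `c` is the cost of a move. -/
def gain (N : X → X → Prop) (c : X → X → ℝ) (f : X → ℝ) (x : X) : ℝ :=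
  ⨆ y : {y // N x y}, (f y - f x - c x y)

/-- The largest net gain `f x - f y - c y x` of a move into `x` from a neighbour `y`. -/
def loss (N : X → X → Prop) (c : X → X → ℝ) (f : X → ℝ) (x : X) : ℝ :=
  gain N (flip c) (-f) x

/-- `f` is a subsolution on `D` of the finite difference equation `loss = gain`. A supersolution `g`
for the cost `c` is encoded by the subsolution `-g` for the reversed cost `flip c`. -/
def IsDiscreteSubsolution (N : X → X → Prop) (c : X → X → ℝ) (D : Set X) (f : X → ℝ) : Prop :=
  ∀ x ∈ D, loss N c f x ≤ gain N c f x

lemma le_gain (hc : ∀ x y, 0 ≤ c x y) (hf : BddAbove (range f)) {x y : X} (h : N x y) :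
    f y - f x - c x y ≤ gain N c f x := by
  obtain ⟨B, hB⟩ := hf
  refine le_ciSup (f := fun y : {y // N x y} => f y - f x - c x y) ⟨B - f x, ?_⟩ ⟨y, h⟩
  rintro _ ⟨z, rfl⟩
  linarith [hB ⟨z.1, rfl⟩, hc x z]

lemma gain_le (hN : ∀ x, N x x) {x : X} {s : ℝ} (h : ∀ y, N x y → f y - f x - c x y ≤ s) :
    gain N c f x ≤ s :=
  have : Nonempty {y // N x y} := ⟨⟨x, hN x⟩⟩
  ciSup_le fun y => h y y.2

lemma exists_lt_of_lt_gain (hN : ∀ x, N x x) {x : X} {s : ℝ} (h : s < gain N c f x) :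
    ∃ y, N x y ∧ s < f y - f x - c x y := by
  by_contra! hcon
  exact (gain_le hN hcon).not_gt h

lemma le_loss (hc : ∀ x y, 0 ≤ c x y) (hf : BddBelow (range f)) {x y : X} (h : N x y) :
    f x - f y - c y x ≤ loss N c f x := by
  have hneg : BddAbove (range (-f)) := by
    obtain ⟨B, hB⟩ := hf
    exact ⟨-B, by rintro _ ⟨z, rfl⟩; exact neg_le_neg (hB ⟨z, rfl⟩)⟩
  have := le_gain (c := flip c) (f := -f) (fun x y => hc y x) hneg h
  simp only [Pi.neg_apply, flip] at this
  unfold loss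
  linarith

lemma loss_le (hN : ∀ x, N x x) {x : X} {s : ℝ} (h : ∀ y, N x y → f x - f y - c y x ≤ s) :
    loss N c f x ≤ s :=
  gain_le hN fun y hy => by
    simp only [Pi.neg_apply, flip]
    linarith [h y hy]

lemma exists_climb (hN : ∀ x, N x x) (hc : ∀ x y, 0 ≤ c x y) (hf : BddBelow (range f))
    (hg : BddBelow (range g)) (hfD : IsDiscreteSubsolution N c D f)
    (hgD : IsDiscreteSubsolution N (flip c) D g) {S η : ℝ} (hS : ∀ x, f x + g x ≤ S) (hη : 0 < η)
    {x : X} (hx : x ∈ D) (hxS : S - η ≤ f x + g x) :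
    ∃ y, gain N c f x - η ≤ f y - f x ∧ S - 3 * η ≤ f y + g y := by
  obtain ⟨y, hxy, hy⟩ := exists_lt_of_lt_gain hN (sub_lt_self (gain N c f x) hη)
  have hgf : gain N (flip c) g x ≤ loss N c f x + η := gain_le hN fun z hz => by
    have := le_loss hc hf hz
    simp only [flip]
    linarith [hS z]
  have hgy : g x - g y - c x y ≤ loss N (flip c) g x := le_loss (fun x y => hc y x) hg hxy
  exact ⟨y, by linarith [hc x y], by linarith [hfD x hx, hgD x hx]⟩

lemma add_le_of_forall_le_gain (hN : ∀ x, N x x) (hc : ∀ x y, 0 ≤ c x y)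
    (hf : IsBounded (range f)) (hg : IsBounded (range g)) (hfD : IsDiscreteSubsolution N c D f)
    (hgD : IsDiscreteSubsolution N (flip c) D g) (hγ : 0 < γ) (hgain : ∀ x ∈ D, γ ≤ gain N c f x)
    {M : ℝ} (hM : ∀ x ∉ D, f x + g x ≤ M) (x : X) : f x + g x ≤ M := by
  by_contra! hx
  have : Nonempty X := ⟨x⟩
  have hbdd : BddAbove (range fun x => f x + g x) := hf.bddAbove.range_add hg.bddAbove
  set S := ⨆ x, (f x + g x)
  have hleS : ∀ z, f z + g z ≤ S := le_ciSup hbdd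
  have hMS : M < S := hx.trans_le (hleS x)
  obtain ⟨b, hb⟩ := hf.bddBelow
  obtain ⟨B, hB⟩ := hf.bddAbove
  have hclimb : ∀ j : ℕ, ∀ η > 0, ∃ z, S - η ≤ f z + g z ∧ b + j * (γ / 2) ≤ f z := by
    intro j
    induction j with
    | zero =>
      intro η hη
      obtain ⟨z, hz⟩ := exists_lt_of_lt_ciSup (sub_lt_self S hη)
      exact ⟨z, hz.le, by simpa using hb ⟨z, rfl⟩⟩
    | succ j ih =>
      intro η hη
      obtain ⟨η', hη', hlt⟩ := exists_between
        (show 0 < min (η / 3) (min (S - M) (γ / 2)) from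
          lt_min (by linarith) (lt_min (by linarith) (by linarith)))
      obtain ⟨hη₁, hη₂, hη₃⟩ : η' < η / 3 ∧ η' < S - M ∧ η' < γ / 2 := by
        simpa only [lt_min_iff] using hlt
      obtain ⟨z, hz, hzj⟩ := ih η' hη'
      have hzD : z ∈ D := by
        by_contra hzD
        linarith [hM z hzD]
      obtain ⟨y, hy, hyS⟩ :=
        exists_climb hN hc hf.bddBelow hg.bddBelow hfD hgD hleS hη' hzD hz
      refine ⟨y, by linarith, ?_⟩
      push_cast
      linarith [hgain z hzD]
  obtain ⟨j, hj⟩ := exists_nat_gt ((B - b) / (γ / 2))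
  rw [div_lt_iff₀ (by linarith)] at hj
  obtain ⟨z, -, hz⟩ := hclimb j 1 one_pos
  linarith [hB ⟨z, rfl⟩]

/-- The functions that lie above `f` off the low-gain set `{x ∈ D | gain N c f x ≤ γ}` and whose
gain is at most `γ` on it. Its least element is the patched function of the comparison argument. -/
def patchFamily (N : X → X → Prop) (c : X → X → ℝ) (D : Set X) (f : X → ℝ) (γ : ℝ) :
    Set (X → ℝ) :=
  {w | (∀ x ∉ {x ∈ D | gain N c f x ≤ γ}, f x ≤ w x) ∧
    ∀ x ∈ {x ∈ D | gain N c f x ≤ γ}, ∀ y, N x y → w y - c x y - γ ≤ w x}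

lemma self_mem_patchFamily (hc : ∀ x y, 0 ≤ c x y) (hf : BddAbove (range f)) :
    f ∈ patchFamily N c D f γ :=
  ⟨fun _ _ => le_rfl, fun _ hx _ hy => by linarith [le_gain hc hf hy, hx.2]⟩

/-- From a low-gain point, escape along moves that decrease the height `h`: such moves are cheap in
both directions, so neither `f` nor a patch can vary much along them. -/
lemma sub_le_of_mem_patchFamily (hc : ∀ x y, 0 ≤ c x y) (hf : BddBelow (range f))
    (hfD : IsDiscreteSubsolution N c D f) (hγ : 0 ≤ γ) {κ : ℝ} (hκ : 0 ≤ κ) {h : X → ℕ}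
    (hh : ∀ x ∈ D, ∃ y, N x y ∧ h y < h x ∧ c x y + c y x ≤ κ)
    (hw : w ∈ patchFamily N c D f γ) (j : ℕ) {x : X} (hj : h x ≤ j) :
    f x - j * (κ + 2 * γ) ≤ w x := by
  induction j generalizing x with
  | zero =>
    suffices x ∉ D by simpa using hw.1 x fun hx => this hx.1
    intro hxD
    obtain ⟨y, -, hy, -⟩ := hh x hxD
    omega
  | succ j ih =>
    by_cases hx : x ∈ {x ∈ D | gain N c f x ≤ γ}
    · obtain ⟨y, hxy, hy, hyκ⟩ := hh x hx.1
      have hwy := ih (show h y ≤ j by omega)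
      have hwx := hw.2 x hx y hxy
      have hfxy := le_loss hc hf hxy
      push_cast
      linarith [hfD x hx.1, hx.2]
    · have : 0 ≤ ((j + 1 : ℕ) : ℝ) * (κ + 2 * γ) := by positivity
      linarith [hw.1 x hx]

lemma exists_isLeast_patchFamily (hc : ∀ x y, 0 ≤ c x y) (hf : BddAbove (range f))
    (hbdd : BddBelow (patchFamily N c D f γ)) : ∃ w, IsLeast (patchFamily N c D f γ) w := by
  have hne : (patchFamily N c D f γ).Nonempty := ⟨f, self_mem_patchFamily hc hf⟩
  have hle : ∀ v ∈ patchFamily N c D f γ, ∀ x, sInf (patchFamily N c D f γ) x ≤ v x :=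
    fun v hv => csInf_le hbdd hv
  have hge : ∀ (x : X) (a : ℝ), (∀ v ∈ patchFamily N c D f γ, a ≤ v x) →
      a ≤ sInf (patchFamily N c D f γ) x := fun x a h => by
    have : Nonempty (patchFamily N c D f γ) := hne.to_subtype
    rw [sInf_apply]
    exact le_ciInf fun v => h v v.2
  refine ⟨_, ⟨fun x hx => hge x _ fun v hv => hv.1 x hx, fun x hx y hy => hge x _ fun v hv => ?_⟩,
    fun v hv => hle v hv⟩
  linarith [hv.2 x hx y hy, hle v hv y]

lemma le_gain_of_isLeast_patchFamily (hc : ∀ x y, 0 ≤ c x y) (hw : BddAbove (range w))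
    (hleast : IsLeast (patchFamily N c D f γ) w) {x : X} (hx : x ∈ D)
    (hxγ : gain N c f x ≤ γ) : γ ≤ gain N c w x := by
  classical
  by_contra! hlt
  set θ := γ - gain N c w x
  have hle : Function.update w x (w x - θ) ≤ w := by
    rw [update_le_self_iff]
    linarith
  have hmem : Function.update w x (w x - θ) ∈ patchFamily N c D f γ := by
    refine ⟨fun y hy => ?_, fun y hy z hz => ?_⟩
    · rw [Function.update_of_ne (by rintro rfl; exact hy ⟨hx, hxγ⟩)]
      exact hleast.1.1 y hy
    · have hzle := hle z
      obtain rfl | hyx := eq_or_ne y x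
      · rw [Function.update_self]
        linarith [le_gain hc hw hz]
      · rw [Function.update_of_ne hyx]
        linarith [hleast.1.2 y hy z hz]
  have hge := hleast.2 hmem x
  rw [Function.update_self] at hge
  linarith

lemma gain_le_gain_of_mem_patchFamily (hN : ∀ x, N x x) (hsymm : ∀ x y, N x y → N y x)
    (hc : ∀ x y, 0 ≤ c x y) (hf : BddBelow (range f)) (hfD : IsDiscreteSubsolution N c D f)
    (hw : BddAbove (range w)) (hmem : w ∈ patchFamily N c D f γ) (hwf : w ≤ f) {x : X}
    (hxγ : γ < gain N c f x) : gain N c f x ≤ gain N c w x := by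
  refine le_of_forall_lt fun s hs => ?_
  obtain ⟨y, hy, hys⟩ := exists_lt_of_lt_gain hN (max_lt hs hxγ)
  obtain ⟨hsy, hγy⟩ := max_lt_iff.1 hys
  -- The move from `x` to `y` shows that the loss, hence the gain, of `f` at `y` exceeds `γ`.
  have hyw : f y ≤ w y := hmem.1 y fun hyW => by
    linarith [le_loss hc hf (hsymm x y hy), hfD y hyW.1, hyW.2]
  linarith [le_gain hc hw hy, hwf x]

lemma loss_le_max_of_mem_patchFamily (hN : ∀ x, N x x) (hsymm : ∀ x y, N x y → N y x)
    (hc : ∀ x y, 0 ≤ c x y) (hf : BddBelow (range f)) (hmem : w ∈ patchFamily N c D f γ)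
    (hwf : w ≤ f) (x : X) : loss N c w x ≤ max γ (loss N c f x) := by
  refine loss_le hN fun y hy => ?_
  by_cases hyW : y ∈ {y ∈ D | gain N c f y ≤ γ}
  · exact le_max_of_le_left (by linarith [hmem.2 y hyW x (hsymm x y hy)])
  · exact le_max_of_le_right (by linarith [hmem.1 y hyW, hwf x, le_loss hc hf hy])

lemma exists_isDiscreteSubsolution_le_gain (hN : ∀ x, N x x) (hsymm : ∀ x y, N x y → N y x)
    (hc : ∀ x y, 0 ≤ c x y) (hf : IsBounded (range f)) (hfD : IsDiscreteSubsolution N c D f)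
    (hγ : 0 ≤ γ) {κ : ℝ} (hκ : 0 ≤ κ) {h : X → ℕ} {J : ℕ} (hJ : ∀ x, h x ≤ J)
    (hh : ∀ x ∈ D, ∃ y, N x y ∧ h y < h x ∧ c x y + c y x ≤ κ) :
    ∃ w ≤ f, (∀ x, f x - J * (κ + 2 * γ) ≤ w x) ∧ (∀ x ∈ D, γ ≤ gain N c w x) ∧
      IsDiscreteSubsolution N c D w := by
  have hlow : ∀ v ∈ patchFamily N c D f γ, ∀ x, f x - J * (κ + 2 * γ) ≤ v x := fun v hv x =>
    sub_le_of_mem_patchFamily hc hf.bddBelow hfD hγ hκ hh hv J (hJ x)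
  obtain ⟨w, hw⟩ := exists_isLeast_patchFamily hc hf.bddAbove
    ⟨fun x => f x - J * (κ + 2 * γ), fun v hv => hlow v hv⟩
  have hwf : w ≤ f := hw.2 (self_mem_patchFamily hc hf.bddAbove)
  have hwbdd : BddAbove (range w) := hf.bddAbove.range_mono f hwf
  have hmax : ∀ x ∈ D, max γ (gain N c f x) ≤ gain N c w x := fun x hx => by
    rcases le_or_gt (gain N c f x) γ with hxγ | hxγ
    · rw [max_eq_left hxγ]
      exact le_gain_of_isLeast_patchFamily hc hwbdd hw hx hxγ
    · rw [max_eq_right hxγ.le]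
      exact gain_le_gain_of_mem_patchFamily hN hsymm hc hf.bddBelow hfD hwbdd hw.1 hwf hxγ
  refine ⟨w, hwf, hlow w hw.1, fun x hx => (le_max_left _ _).trans (hmax x hx), fun x hx => ?_⟩
  exact (loss_le_max_of_mem_patchFamily hN hsymm hc hf.bddBelow hw.1 hwf x).trans
    ((max_le_max_left γ (hfD x hx)).trans (hmax x hx))

lemma IsDiscreteSubsolution.add_le (hN : ∀ x, N x x) (hsymm : ∀ x y, N x y → N y x)
    (hc : ∀ x y, 0 ≤ c x y) (hf : IsBounded (range f)) (hg : IsBounded (range g))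
    (hfD : IsDiscreteSubsolution N c D f) (hgD : IsDiscreteSubsolution N (flip c) D g)
    {κ : ℝ} (hκ : 0 ≤ κ) {h : X → ℕ} {J : ℕ} (hJ : ∀ x, h x ≤ J)
    (hh : ∀ x ∈ D, ∃ y, N x y ∧ h y < h x ∧ c x y + c y x ≤ κ)
    {M : ℝ} (hM : ∀ x ∉ D, f x + g x ≤ M) (x : X) : f x + g x ≤ M + J * κ := by
  have hγ : ∀ γ > 0, f x + g x ≤ M + J * (κ + 2 * γ) := fun γ hγ => by
    obtain ⟨w, hwf, hlow, hgain, hw⟩ :=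
      exists_isDiscreteSubsolution_le_gain hN hsymm hc hf hfD hγ.le hκ hJ hh
    have hwbdd : IsBounded (range w) := by
      rw [isBounded_iff_bddBelow_bddAbove]
      obtain ⟨b, hb⟩ := hf.bddBelow
      refine ⟨⟨b - J * (κ + 2 * γ), ?_⟩, hf.bddAbove.range_mono f hwf⟩
      rintro _ ⟨z, rfl⟩
      linarith [hb ⟨z, rfl⟩, hlow z]
    have := add_le_of_forall_le_gain hN hc hwbdd hg hw hgD hγ hgain
      (fun z hz => (add_le_add_left (hwf z) _).trans (hM z hz)) x
    linarith [hlow x]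
  have hlim : Tendsto (fun γ : ℝ => M + J * (κ + 2 * γ)) (𝓝[>] 0) (𝓝 (M + J * κ)) := by
    refine Tendsto.mono_left ?_ nhdsWithin_le_nhds
    exact Continuous.tendsto' (by fun_prop) _ _ (by ring)
  exact ge_of_tendsto hlim (eventually_mem_nhdsWithin.mono hγ)

end DiscreteComparison

section Cost

variable {E : Type*} [NormedAddCommGroup E] [InnerProductSpace ℝ E] {H : E → ℝ} {S s t ε : ℝ}

/-- The cost of the displacement `w` in time `t`: `t L(w / t)`, where `L` is the Legendre transform
of the restriction of `H` to the sublevel set `{H ≤ S}`. The restriction keeps `L` finite and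
Lipschitz continuous. -/
def cost (H : E → ℝ) (S t : ℝ) (w : E) : ℝ :=
  sSup ((fun p => inner ℝ p w - t * H p) '' {p | H p ≤ S})

/-- The support function of the sublevel set `{H ≤ s}`: its translates are the generalized cones of
slope `s`. -/
def cone (H : E → ℝ) (s : ℝ) (w : E) : ℝ :=
  cost H s 0 w

/-- The Hamiltonians of the comparison theorem: convex functions that attain their minimum `0` at
the origin and have a bounded zero set. -/
structure IsHamiltonian (H : E → ℝ) : Prop where
  convexOn : ConvexOn ℝ univ H
  map_zero : H 0 = 0
  nonneg : ∀ p, 0 ≤ H p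
  isBounded_zeros : IsBounded {p | H p = 0}

lemma cost_comp_neg (S t : ℝ) (w : E) : cost (fun p => H (-p)) S t w = cost H S t (-w) := by
  unfold cost
  congr 1
  ext r
  constructor
  · rintro ⟨p, hp, rfl⟩
    exact ⟨-p, hp, by simp⟩
  · rintro ⟨p, hp, rfl⟩
    exact ⟨-p, by simpa using hp, by simp⟩

lemma inner_inv_norm_smul_self (w : E) : inner ℝ (‖w‖⁻¹ • w) w = ‖w‖ := by
  rw [real_inner_smul_left, real_inner_self_eq_norm_mul_norm, ← mul_assoc, inv_mul_mul_self]

lemma norm_inv_norm_smul_le_one (w : E) : ‖‖w‖⁻¹ • w‖ ≤ 1 := by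
  rw [norm_smul, norm_inv, norm_norm]
  exact inv_mul_le_one

namespace IsHamiltonian

lemma comp_neg (hH : IsHamiltonian H) : IsHamiltonian fun p => H (-p) where
  convexOn := by simpa [Function.comp_def] using hH.convexOn.comp_linearMap (-LinearMap.id)
  map_zero := by rw [neg_zero, hH.map_zero]
  nonneg p := hH.nonneg (-p)
  isBounded_zeros := hH.isBounded_zeros.neg

lemma convex_zeros (hH : IsHamiltonian H) : Convex ℝ {p | H p = 0} := by
  convert hH.convexOn.convex_le 0 using 1
  ext p
  simp [le_antisymm_iff, hH.nonneg p]

variable [FiniteDimensional ℝ E]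

lemma continuous (hH : IsHamiltonian H) : Continuous H :=
  continuousOn_univ.1 (hH.convexOn.continuousOn isOpen_univ)

lemma exists_pos_le_of_norm_eq (hH : IsHamiltonian H) :
    ∃ R > 0, ∃ c > 0, ∀ p, ‖p‖ = R → c ≤ H p := by
  obtain ⟨R, hR, hzeros⟩ := hH.isBounded_zeros.exists_pos_norm_lt
  refine ⟨R, hR, ?_⟩
  rcases (sphere (0 : E) R).eq_empty_or_nonempty with h | h
  · exact ⟨1, one_pos, fun p hp => (h.subset (mem_sphere_zero_iff_norm.2 hp)).elim⟩
  · obtain ⟨p, hp, hmin⟩ :=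
      (isCompact_sphere (0 : E) R).exists_isMinOn h hH.continuous.continuousOn
    refine ⟨H p, (hH.nonneg p).lt_of_ne' fun hp0 => ?_, fun q hq => ?_⟩
    · exact (hzeros p hp0).ne (mem_sphere_zero_iff_norm.1 hp)
    · exact hmin (mem_sphere_zero_iff_norm.2 hq)

lemma exists_mul_norm_le (hH : IsHamiltonian H) :
    ∃ R > 0, ∃ c > 0, ∀ p, R ≤ ‖p‖ → c * ‖p‖ ≤ H p := by
  obtain ⟨R, hR, c, hc, hsphere⟩ := hH.exists_pos_le_of_norm_eq
  refine ⟨R, hR, c / R, by positivity, fun p hp => ?_⟩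
  have hp0 : 0 < ‖p‖ := hR.trans_le hp
  have hscaled : c ≤ H ((R / ‖p‖) • p) := hsphere _ (by
    rw [norm_smul, Real.norm_of_nonneg (by positivity)]
    field_simp)
  have hconv : H ((R / ‖p‖) • p) ≤ R / ‖p‖ * H p := by
    have := hH.convexOn.2 (mem_univ p) (mem_univ 0) (show 0 ≤ R / ‖p‖ by positivity)
      (sub_nonneg.2 ((div_le_one hp0).2 hp)) (add_sub_cancel _ _)
    simpa [hH.map_zero] using this
  calc c / R * ‖p‖ ≤ R / ‖p‖ * H p / R * ‖p‖ := by gcongr; exact hscaled.trans hconv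
    _ = H p := by field_simp

lemma isCompact_sublevel (hH : IsHamiltonian H) (s : ℝ) : IsCompact {p | H p ≤ s} := by
  refine isCompact_of_isClosed_isBounded (isClosed_le hH.continuous continuous_const) ?_
  obtain ⟨R, -, c, hc, hgrowth⟩ := hH.exists_mul_norm_le
  refine isBounded_iff_forall_norm_le.2 ⟨max R (s / c), fun p (hp : H p ≤ s) => ?_⟩
  rcases le_total ‖p‖ R with h | h
  · exact h.trans (le_max_left _ _)
  · refine le_trans ?_ (le_max_right _ _)
    rw [le_div_iff₀ hc]
    linarith [hgrowth p h]

lemma exists_le_of_norm_le (hH : IsHamiltonian H) (K : ℝ) : ∃ k, ∀ p, ‖p‖ ≤ K → H p ≤ k := by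
  obtain ⟨k, hk⟩ := ((isCompact_closedBall (0 : E) K).image hH.continuous).bddAbove
  exact ⟨k, fun p hp => hk ⟨p, mem_closedBall_zero_iff.2 hp, rfl⟩⟩

lemma inner_sub_le_cost (hH : IsHamiltonian H) {p : E} (hp : H p ≤ S) (t : ℝ) (w : E) :
    inner ℝ p w - t * H p ≤ cost H S t w :=
  have := hH.continuous
  le_csSup ((hH.isCompact_sublevel S).image (by fun_prop)).bddAbove ⟨p, hp, rfl⟩

lemma exists_cost_eq (hH : IsHamiltonian H) (hS : 0 ≤ S) (t : ℝ) (w : E) :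
    ∃ p, H p ≤ S ∧ cost H S t w = inner ℝ p w - t * H p := by
  have := hH.continuous
  have hne : {p | H p ≤ S}.Nonempty := ⟨0, hH.map_zero.trans_le hS⟩
  obtain ⟨p, hp, h⟩ := ((hH.isCompact_sublevel S).image
    (f := fun p => inner ℝ p w - t * H p) (by fun_prop)).sSup_mem (hne.image _)
  exact ⟨p, hp, h.symm⟩

lemma cost_nonneg (hH : IsHamiltonian H) (hS : 0 ≤ S) (t : ℝ) (w : E) : 0 ≤ cost H S t w := by
  simpa [hH.map_zero] using hH.inner_sub_le_cost (hH.map_zero.trans_le hS) t w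

lemma cost_zero (hH : IsHamiltonian H) (hS : 0 ≤ S) (ht : 0 ≤ t) : cost H S t 0 = 0 := by
  refine le_antisymm ?_ (hH.cost_nonneg hS t 0)
  obtain ⟨p, -, hp⟩ := hH.exists_cost_eq hS t 0
  rw [hp, inner_zero_right]
  linarith [mul_nonneg ht (hH.nonneg p)]

lemma cost_smul (hH : IsHamiltonian H) (hS : 0 ≤ S) {a : ℝ} (ha : 0 ≤ a) (t : ℝ) (w : E) :
    cost H S (a * t) (a • w) = a * cost H S t w := by
  have hscale : ∀ p, inner ℝ p (a • w) - a * t * H p = a * (inner ℝ p w - t * H p) := fun p => by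
    rw [real_inner_smul_right]
    ring
  apply le_antisymm
  · obtain ⟨p, hp, h⟩ := hH.exists_cost_eq hS (a * t) (a • w)
    rw [h, hscale]
    exact mul_le_mul_of_nonneg_left (hH.inner_sub_le_cost hp t w) ha
  · obtain ⟨p, hp, h⟩ := hH.exists_cost_eq hS t w
    rw [h, ← hscale]
    exact hH.inner_sub_le_cost hp _ _

lemma inner_le_cone (hH : IsHamiltonian H) {p : E} (hp : H p ≤ s) (w : E) :
    inner ℝ p w ≤ cone H s w := by
  simpa [cone] using hH.inner_sub_le_cost hp 0 w

lemma exists_cone_eq (hH : IsHamiltonian H) (hs : 0 ≤ s) (w : E) :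
    ∃ p, H p ≤ s ∧ cone H s w = inner ℝ p w := by
  simpa [cone] using hH.exists_cost_eq hs 0 w

lemma cone_zero (hH : IsHamiltonian H) (hs : 0 ≤ s) : cone H s 0 = 0 :=
  hH.cost_zero hs le_rfl

lemma cone_smul (hH : IsHamiltonian H) (hs : 0 ≤ s) {a : ℝ} (ha : 0 ≤ a) (w : E) :
    cone H s (a • w) = a * cone H s w := by
  simpa [cone] using hH.cost_smul hs ha 0 w

lemma exists_lipschitzWith_cone (hH : IsHamiltonian H) (hs : 0 ≤ s) :
    ∃ K, LipschitzWith K (cone H s) := by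
  obtain ⟨R, hR⟩ := (hH.isCompact_sublevel s).isBounded.exists_norm_le
  refine ⟨R.toNNReal, LipschitzWith.of_le_add_mul _ fun x y => ?_⟩
  obtain ⟨p, hp, h⟩ := hH.exists_cone_eq hs x
  have hpR : ‖p‖ ≤ R.toNNReal := (hR p hp).trans (Real.le_coe_toNNReal R)
  calc cone H s x = inner ℝ p y + inner ℝ p (x - y) := by rw [h, ← inner_add_right]; simp
    _ ≤ cone H s y + ‖p‖ * ‖x - y‖ := add_le_add (hH.inner_le_cone hp y) (real_inner_le_norm _ _)
    _ ≤ cone H s y + R.toNNReal * dist x y := by rw [dist_eq_norm]; gcongr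

lemma continuous_cone (hH : IsHamiltonian H) (hs : 0 ≤ s) : Continuous (cone H s) :=
  let ⟨_, hK⟩ := hH.exists_lipschitzWith_cone hs
  hK.continuous

lemma concaveOn_cone (hH : IsHamiltonian H) (w : E) :
    ConcaveOn ℝ (Ici 0) fun s => cone H s w := by
  refine ⟨convex_Ici 0, fun s hs r hr a b ha hb hab => ?_⟩
  obtain ⟨p, hp, h⟩ := hH.exists_cone_eq hs w
  obtain ⟨q, hq, h'⟩ := hH.exists_cone_eq hr w
  simp only [h, h', smul_eq_mul]
  rw [← real_inner_smul_left, ← real_inner_smul_left, ← inner_add_left]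
  refine hH.inner_le_cone ((hH.convexOn.2 (mem_univ p) (mem_univ q) ha hb hab).trans ?_) w
  simp only [smul_eq_mul]
  gcongr

lemma map_gradient_cone_le [CompleteSpace E] (hH : IsHamiltonian H) (hs : 0 ≤ s) (z : E) (b : ℝ)
    (x : E) : H (gradient (fun y => cone H s (y - z) + b) x) ≤ s := by
  by_cases hd : DifferentiableAt ℝ (fun y => cone H s (y - z) + b) x
  swap
  · rwa [gradient_eq_zero_of_not_differentiableAt hd, hH.map_zero]
  -- A `p ∈ {H ≤ s}` realizing the cone at `x - z` is a subgradient of the cone there.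
  obtain ⟨p, hp, h⟩ := hH.exists_cone_eq hs (x - z)
  have hmin : IsLocalMin (fun y => cone H s (y - z) + b - inner ℝ p y) x :=
    Eventually.of_forall fun y => by
      have := hH.inner_le_cone hp (y - z)
      rw [inner_sub_right] at this h
      simp only [h]
      linarith
  have hfderiv := hmin.hasFDerivAt_eq_zero
    (hd.hasGradientAt.hasFDerivAt.sub (innerSL ℝ p).hasFDerivAt)
  have hgrad : gradient (fun y => cone H s (y - z) + b) x = p := by
    refine ext_inner_right ℝ fun v => ?_
    simpa [sub_eq_zero] using DFunLike.congr_fun hfderiv v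
  rwa [hgrad]

lemma cone_sub_le_cost (hH : IsHamiltonian H) (hs : 0 ≤ s) (hsS : s ≤ S) (ht : 0 ≤ t) (w : E) :
    cone H s w - t * s ≤ cost H S t w := by
  obtain ⟨p, hp, h⟩ := hH.exists_cone_eq hs w
  linarith [hH.inner_sub_le_cost (hp.trans hsS) t w, mul_le_mul_of_nonneg_left hp ht]

lemma exists_cost_eq_cone_sub (hH : IsHamiltonian H) (hS : 0 ≤ S) (ht : 0 ≤ t) (w : E) :
    ∃ s ∈ Icc 0 S, cost H S t w = cone H s w - t * s := by
  obtain ⟨p, hp, h⟩ := hH.exists_cost_eq hS t w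
  refine ⟨H p, ⟨hH.nonneg p, hp⟩, le_antisymm ?_ (hH.cone_sub_le_cost (hH.nonneg p) hp ht w)⟩
  linarith [hH.inner_le_cone le_rfl w (p := p)]

lemma mul_norm_le_cost (hH : IsHamiltonian H) {K k : ℝ} (hK : 0 ≤ K)
    (hk : ∀ p, ‖p‖ ≤ K → H p ≤ k) (hkS : k ≤ S) (ht : 0 ≤ t) (w : E) :
    K * ‖w‖ ≤ cost H S t w + t * k := by
  have hp : H (K • ‖w‖⁻¹ • w) ≤ k := hk _ (by
    rw [norm_smul, Real.norm_of_nonneg hK]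
    exact mul_le_of_le_one_right hK (norm_inv_norm_smul_le_one w))
  have hcost := hH.inner_sub_le_cost (hp.trans hkS) t w
  rw [real_inner_smul_left, inner_inv_norm_smul_self] at hcost
  linarith [mul_le_mul_of_nonneg_left hp ht]

end IsHamiltonian

/-- The parameters of a sup-convolution at scale `ρ` of a function with Lipschitz constant `K`. The
level `k` bounds the slopes of the function. The gap between the cones of slope `k` and `S` makes
the cut-off at level `S` harmless, and `t` is so short a time that the sup-convolution
looks no further than `ρ`. -/
structure IsAdmissibleScale (H : E → ℝ) (K : NNReal) (ρ k S t : ℝ) : Prop where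
  map_le : ∀ p, ‖p‖ ≤ K → H p ≤ k
  level_le : k ≤ S
  cone_add_norm_le : ∀ w, cone H k w + ‖w‖ ≤ cone H S w
  time_pos : 0 < t
  time_mul_le : t * S ≤ ρ

namespace IsAdmissibleScale

variable {K : NNReal} {ρ k : ℝ}

lemma comp_neg (hsc : IsAdmissibleScale H K ρ k S t) :
    IsAdmissibleScale (fun p => H (-p)) K ρ k S t where
  map_le p hp := hsc.map_le (-p) (by rwa [norm_neg])
  level_le := hsc.level_le
  cone_add_norm_le w := by
    simpa [cone, cost_comp_neg] using hsc.cone_add_norm_le (-w)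
  time_pos := hsc.time_pos
  time_mul_le := hsc.time_mul_le

lemma level_nonneg (hsc : IsAdmissibleScale H K ρ k S t) (hH : IsHamiltonian H) : 0 ≤ k :=
  (hH.nonneg 0).trans (hsc.map_le 0 (by simp))

lemma top_nonneg (hsc : IsAdmissibleScale H K ρ k S t) (hH : IsHamiltonian H) : 0 ≤ S :=
  (hsc.level_nonneg hH).trans hsc.level_le

end IsAdmissibleScale

variable [FiniteDimensional ℝ E]

namespace IsHamiltonian

lemma exists_cone_add_norm_le (hH : IsHamiltonian H) {k : ℝ} (hk : 0 ≤ k) :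
    ∃ S ≥ k, ∀ w, cone H k w + ‖w‖ ≤ cone H S w := by
  obtain ⟨R, hR⟩ := (hH.isCompact_sublevel k).isBounded.exists_norm_le
  obtain ⟨S, hS⟩ := hH.exists_le_of_norm_le (R + 1)
  refine ⟨max k S, le_max_left _ _, fun w => ?_⟩
  obtain ⟨p, hp, h⟩ := hH.exists_cone_eq hk w
  have hpw : H (p + ‖w‖⁻¹ • w) ≤ S :=
    hS _ ((norm_add_le _ _).trans (add_le_add (hR p hp) (norm_inv_norm_smul_le_one w)))
  have := hH.inner_le_cone (hpw.trans (le_max_right k S)) w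
  rwa [inner_add_left, inner_inv_norm_smul_self, ← h] at this

lemma exists_isAdmissibleScale (hH : IsHamiltonian H) (K : NNReal) {ρ : ℝ} (hρ : 0 < ρ) :
    ∃ k S t, IsAdmissibleScale H K ρ k S t := by
  obtain ⟨k, hk⟩ := hH.exists_le_of_norm_le K
  have hk0 : 0 ≤ k := (hH.nonneg 0).trans (hk 0 (by simp))
  obtain ⟨S, hkS, hS⟩ := hH.exists_cone_add_norm_le hk0
  have hS0 : 0 ≤ S := hk0.trans hkS
  refine ⟨k, S, ρ / (S + 1), hk, hkS, hS, by positivity, ?_⟩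
  rw [div_mul_eq_mul_div, div_le_iff₀ (by positivity)]
  linarith

end IsHamiltonian

lemma exists_unit_orthogonal_of_interior_eq_empty {Z : Set E} (hZ : Convex ℝ Z) (h0 : (0 : E) ∈ Z)
    (hint : interior Z = ∅) : ∃ e : E, ‖e‖ = 1 ∧ ∀ p ∈ Z, inner ℝ p e = 0 := by
  have hspan : Submodule.span ℝ Z ≠ ⊤ := fun h => by
    have haff : affineSpan ℝ Z = ⊤ := by
      rw [AffineSubspace.affineSpan_eq_top_iff_vectorSpan_eq_top_of_nonempty ℝ E E ⟨0, h0⟩,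
        vectorSpan_eq_span_vsub_set_right ℝ h0]
      simpa using h
    exact (hZ.interior_nonempty_iff_affineSpan_eq_top.2 haff).ne_empty hint
  obtain ⟨e, he, he0⟩ :=
    Submodule.exists_mem_ne_zero_of_ne_bot (mt Submodule.orthogonal_eq_bot_iff.1 hspan)
  refine ⟨‖e‖⁻¹ • e, norm_smul_inv_norm he0, fun p hp => ?_⟩
  rw [inner_smul_right, he p (Submodule.subset_span hp), mul_zero]

namespace IsHamiltonian

lemma exists_abs_inner_le (hH : IsHamiltonian H) {e : E}
    (he : ∀ p, H p = 0 → inner ℝ p e = 0) (S : ℝ) (hε : 0 < ε) :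
    ∃ m > 0, ∀ p, H p ≤ S → |inner ℝ p e| ≤ ε + m * H p := by
  have hcpt : IsCompact ({p | H p ≤ S} ∩ {p | ε ≤ |inner ℝ p e|}) :=
    (hH.isCompact_sublevel S).inter_right (isClosed_le continuous_const (by fun_prop))
  rcases ({p | H p ≤ S} ∩ {p | ε ≤ |inner ℝ p e|}).eq_empty_or_nonempty with h | h
  · refine ⟨1, one_pos, fun p hp => ?_⟩
    have : |inner ℝ p e| < ε := not_le.1 fun hpe => h.subset ⟨hp, hpe⟩
    linarith [hH.nonneg p]
  obtain ⟨p₀, ⟨-, hp₀⟩, hmin⟩ := hcpt.exists_isMinOn h hH.continuous.continuousOn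
  have hpos : 0 < H p₀ := (hH.nonneg p₀).lt_of_ne' fun h0 => by
    simp only [mem_ofPred_eq, he p₀ h0, abs_zero] at hp₀
    linarith
  obtain ⟨R, hR⟩ :=
    ((hH.isCompact_sublevel S).image (f := fun p => |inner ℝ p e|) (by fun_prop)).bddAbove
  refine ⟨max R 1 / H p₀, by positivity, fun p hp => ?_⟩
  by_cases hpe : ε ≤ |inner ℝ p e|
  · have hratio : 1 ≤ H p / H p₀ := (one_le_div hpos).2 (hmin ⟨hp, hpe⟩)
    calc |inner ℝ p e| ≤ max R 1 := (hR ⟨p, hp, rfl⟩).trans (le_max_left _ _)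
      _ ≤ max R 1 * (H p / H p₀) := le_mul_of_one_le_right (by positivity) hratio
      _ = max R 1 / H p₀ * H p := by ring
      _ ≤ ε + max R 1 / H p₀ * H p := le_add_of_nonneg_left hε.le
  · have := hH.nonneg p
    exact (not_le.1 hpe).le.trans (le_add_of_nonneg_right (by positivity))

lemma exists_cost_smul_le (hH : IsHamiltonian H) {e : E} (he : ∀ p, H p = 0 → inner ℝ p e = 0)
    (hS : 0 ≤ S) (ht : 0 < t) (hε : 0 < ε) :
    ∃ η₀ > 0, ∀ a : ℝ, |a| ≤ η₀ → cost H S t (a • e) ≤ |a| * ε := by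
  obtain ⟨m, hm, hme⟩ := hH.exists_abs_inner_le he S hε
  refine ⟨t / m, by positivity, fun a ha => ?_⟩
  rw [le_div_iff₀ hm] at ha
  obtain ⟨p, hp, h⟩ := hH.exists_cost_eq hS t (a • e)
  have hpos := hH.nonneg p
  calc cost H S t (a • e) ≤ |a * inner ℝ p e| - t * H p := by
        rw [h, inner_smul_right]
        gcongr
        exact le_abs_self _
    _ ≤ |a| * (ε + m * H p) - |a| * m * H p := by
        rw [abs_mul]
        gcongr
        exact hme p hp
    _ = |a| * ε := by ring

end IsHamiltonian

end Cost

section Segments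

variable {E : Type*} [NormedAddCommGroup E] [NormedSpace ℝ E] {W : Set E} {u : E → ℝ}
  {K : NNReal} {C : ℝ} {x w : E}

lemma sub_le_mul_of_ae_deriv_le {g : ℝ → ℝ} {a b : ℝ} (hab : a ≤ b)
    (hg : LipschitzOnWith K g (Icc a b)) (hC : ∀ᵐ s, s ∈ Icc a b → deriv g s ≤ C) :
    g b - g a ≤ (b - a) * C := by
  have hac := (uIcc_of_le hab ▸ hg :
    LipschitzOnWith K g (uIcc a b)).absolutelyContinuousOnInterval
  calc g b - g a = ∫ s in a..b, deriv g s := hac.integral_deriv_eq_sub.symm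
    _ ≤ ∫ _ in a..b, C :=
      intervalIntegral.integral_mono_ae_restrict hab hac.intervalIntegrable_deriv
        intervalIntegrable_const ((ae_restrict_iff' measurableSet_Icc).2 hC)
    _ = (b - a) * C := by simp

lemma sub_le_of_ae_fderiv_le_on_line (hu : LipschitzOnWith K u W)
    (hseg : ∀ s ∈ Icc (0 : ℝ) 1, x + s • w ∈ W)
    (hC : ∀ᵐ s : ℝ, x + s • w ∈ W →
      DifferentiableAt ℝ u (x + s • w) ∧ fderiv ℝ u (x + s • w) w ≤ C) :
    u (x + w) - u x ≤ C := by
  have hline : LipschitzWith ‖w‖₊ fun s : ℝ => x + s • w :=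
    LipschitzWith.of_dist_le_mul fun s r => by
      rw [dist_add_left, dist_eq_norm, ← sub_smul, norm_smul, mul_comm, ← dist_eq_norm,
        coe_nnnorm]
  have hlip : LipschitzOnWith (K * ‖w‖₊) (fun s : ℝ => u (x + s • w)) (Icc 0 1) :=
    hu.comp hline.lipschitzOnWith hseg
  have hderiv : ∀ᵐ s, s ∈ Icc (0 : ℝ) 1 → deriv (fun s : ℝ => u (x + s • w)) s ≤ C := by
    filter_upwards [hC] with s hs hs01
    obtain ⟨hdiff, hle⟩ := hs (hseg s hs01)
    have hl : HasDerivAt (fun s : ℝ => x + s • w) w s := by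
      simpa using ((hasDerivAt_id s).smul_const w).const_add x
    exact (hdiff.hasFDerivAt.comp_hasDerivAt s hl).deriv.trans_le hle
  simpa using sub_le_mul_of_ae_deriv_le zero_le_one hlip hderiv

variable [FiniteDimensional ℝ E] [MeasurableSpace E] [BorelSpace E] {μ : Measure E}
  [μ.IsAddHaarMeasure]

lemma ae_ae_add_smul {P : E → Prop} (hP : ∀ᵐ x ∂μ, P x) (w : E) :
    ∀ᵐ x ∂μ, ∀ᵐ s : ℝ, P (x + s • w) := by
  obtain ⟨s, hsP, hs, hs0⟩ := exists_measurable_superset_of_null hP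
  have hae : ∀ᵐ x ∂μ, x ∈ sᶜ := measure_eq_zero_iff_ae_notMem.1 hs0
  filter_upwards [(ae_ae_add_linearMap_mem_iff (LinearMap.toSpanSingleton ℝ E w) volume μ
    hs.compl).2 hae] with x hx
  filter_upwards [hx] with r hr
  by_contra hPr
  exact hr (hsP hPr)

/-- The bound holds along almost every parallel of the segment, and passes to the limit. -/
lemma sub_le_of_ae_fderiv_le (hW : IsOpen W) (hu : LipschitzOnWith K u W)
    (hC : ∀ᵐ y ∂μ, y ∈ W → fderiv ℝ u y w ≤ C)
    (hseg : ∀ s ∈ Icc (0 : ℝ) 1, x + s • w ∈ W) : u (x + w) - u x ≤ C := by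
  have hdiff : ∀ᵐ y ∂μ, y ∈ W → DifferentiableAt ℝ u y ∧ fderiv ℝ u y w ≤ C := by
    filter_upwards [hu.ae_differentiableWithinAt_of_mem (μ := μ), hC] with y hy hyC hyW
    exact ⟨(hy hyW).differentiableAt (hW.mem_nhds hyW), hyC hyW⟩
  have hnear : ∀ᶠ y in 𝓝 x, ∀ s ∈ Icc (0 : ℝ) 1, y + s • w ∈ W :=
    isCompact_Icc.eventually_forall_of_forall_eventually fun s hs =>
      (show Continuous fun z : E × ℝ => z.1 + z.2 • w by fun_prop).continuousAt.eventually_mem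
        (hW.mem_nhds (hseg s hs))
  have hfreq : ∃ᶠ y in 𝓝 x, u (y + w) - u y ≤ C := by
    have hdense := Measure.dense_of_ae (ae_ae_add_smul hdiff w) x
    rw [mem_closure_iff_frequently] at hdense
    exact (hdense.and_eventually hnear).mono fun y ⟨hy, hyW⟩ =>
      sub_le_of_ae_fderiv_le_on_line hu hyW hy
  have hcont : ∀ y ∈ W, ContinuousAt u y := fun y hy =>
    hu.continuousOn.continuousAt (hW.mem_nhds hy)
  refine le_of_tendsto_of_frequently (f := fun y => u (y + w) - u y) ?_ hfreq
  refine ContinuousAt.sub (ContinuousAt.comp (g := u) (hcont _ ?_) (by fun_prop)) (hcont _ ?_)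
  · simpa using hseg 1 (by simp)
  · simpa using hseg 0 (by simp)

end Segments

section ComparisonWithCones

variable {n : ℕ} {H : EuclideanSpace ℝ (Fin n) → ℝ} {U V W : Set (EuclideanSpace ℝ (Fin n))}
  {u v φ : EuclideanSpace ℝ (Fin n) → ℝ} {K : NNReal} {s : ℝ}

/-- Comparison with cones from above: on an open `V ≪ U`, a generalized cone of slope `s` with
vertex `z` lies above `u` as soon as it does so on the frontier of `V` and at the vertex (if the
vertex belongs to `V`). -/
def ComparisonWithCones (H : EuclideanSpace ℝ (Fin n) → ℝ) (U : Set (EuclideanSpace ℝ (Fin n)))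
    (u : EuclideanSpace ℝ (Fin n) → ℝ) : Prop :=
  ∀ V, CompactlyInside V U → ∀ s ≥ 0, ∀ z b,
    (∀ y ∈ frontier V, u y ≤ cone H s (y - z) + b) → (z ∈ V → u z ≤ b) →
    ∀ y ∈ V, u y ≤ cone H s (y - z) + b

lemma CompactlyInside.mono (hV : CompactlyInside V U) (hW : IsOpen W) (hWV : W ⊆ V) :
    CompactlyInside W U :=
  ⟨hW, hV.2.1.of_isClosed_subset isClosed_closure (closure_mono hWV),
    (closure_mono hWV).trans hV.2.2⟩

lemma LipLoc.continuousOn (hu : LipLoc U u) (hU : IsOpen U) : ContinuousOn u U := by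
  intro x hx
  obtain ⟨r, hr, hsub⟩ := nhds_basis_closedBall.mem_iff.1 (hU.mem_nhds hx)
  obtain ⟨K, hK⟩ := hu (ball x r) ⟨isOpen_ball,
    (isCompact_closedBall x r).of_isClosed_subset isClosed_closure closure_ball_subset_closedBall,
    closure_ball_subset_closedBall.trans hsub⟩
  exact (hK.continuousOn.continuousAt (ball_mem_nhds x hr)).continuousWithinAt

lemma isOpen_sep_lt (hV : IsOpen V) (hu : ContinuousOn u V) (hφ : Continuous φ) :
    IsOpen {y ∈ V | φ y < u y} :=
  (hφ.continuousOn.prodMk hu).isOpen_inter_preimage hV isOpen_lt_prod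

lemma competitor_sep_lt (hV : CompactlyInside V U) (hu : ContinuousOn u U)
    (hφ : LipschitzWith K φ) (hfr : ∀ y ∈ frontier V, u y ≤ φ y) :
    Competitor {y ∈ V | φ y < u y} u φ := by
  refine ⟨fun _ _ => ⟨K, hφ.lipschitzOnWith⟩, hφ.continuous.continuousOn, fun y hy => ?_⟩
  have hVU : closure V ⊆ U := hV.2.2
  have hyV : y ∈ closure V := closure_mono (sep_subset _ _) (frontier_subset_closure hy)
  have hge : φ y ≤ u y := closure_minimal (s := {y ∈ V | φ y < u y})
    (t := {y ∈ closure V | φ y ≤ u y}) (fun z hz => ⟨subset_closure hz.1, hz.2.le⟩)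
    (isClosed_closure.isClosed_le hφ.continuous.continuousOn (hu.mono hVU))
    (frontier_subset_closure hy) |>.2
  rw [(isOpen_sep_lt hV.1 (hu.mono (subset_closure.trans hVU)) hφ.continuous).frontier_eq] at hy
  by_cases hyV' : y ∈ V
  · exact hge.antisymm (not_lt.1 fun hlt => hy.2 ⟨hyV', hlt⟩)
  · exact hge.antisymm (hfr y (by rw [hV.1.frontier_eq]; exact ⟨hyV, hyV'⟩))

lemma AbsSubminimizing.ae_map_gradient_le (hu : AbsSubminimizing H U u)
    (hW : CompactlyInside W U) (hφ : Competitor W u φ) (hφu : ∀ y ∈ W, φ y ≤ u y)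
    (hs : ∀ y, H (gradient φ y) ≤ s) : ∀ᵐ y, y ∈ W → H (gradient u y) ≤ s := by
  have hsup : supH H W u ≤ (s : EReal) := (hu.2 W hW φ hφ hφu).trans
    (essSup_le_of_ae_le _ (Eventually.of_forall fun y => EReal.coe_le_coe_iff.2 (hs y)))
  rw [← ae_restrict_iff' hW.1.measurableSet]
  filter_upwards [ae_le_essSup (μ := volume.restrict W)
    (f := fun y => ((H (gradient u y) : ℝ) : EReal))] with y hy
  exact EReal.coe_le_coe_iff.1 (hy.trans hsup)

lemma sub_le_cone_of_ae_map_gradient_le (hH : IsHamiltonian H) (hW : IsOpen W)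
    (hu : LipschitzOnWith K u W) (hgrad : ∀ᵐ y, y ∈ W → H (gradient u y) ≤ s)
    {x w : EuclideanSpace ℝ (Fin n)} (hseg : ∀ r ∈ Icc (0 : ℝ) 1, x + r • w ∈ W) :
    u (x + w) - u x ≤ cone H s w := by
  refine sub_le_of_ae_fderiv_le (μ := volume) hW hu ?_ hseg
  filter_upwards [hgrad] with y hy hyW
  rw [← inner_gradient_left]
  exact hH.inner_le_cone (hy hyW) w

lemma exists_last_exit {X : Type*} [TopologicalSpace X] {W : Set X} (hW : IsOpen W) {γ : ℝ → X}
    (hγ : Continuous γ) (h0 : γ 0 ∉ W) (h1 : γ 1 ∈ W) :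
    ∃ r₀ ∈ Ico (0 : ℝ) 1, γ r₀ ∉ W ∧ ∀ r ∈ Ioc r₀ 1, γ r ∈ W := by
  have hcpt : IsCompact (Icc (0 : ℝ) 1 ∩ γ ⁻¹' Wᶜ) :=
    isCompact_Icc.inter_right (hW.isClosed_compl.preimage hγ)
  obtain ⟨r₀, ⟨hr₀, hr₀W⟩, hmax⟩ :=
    hcpt.exists_isMaxOn ⟨0, ⟨by simp, h0⟩⟩ continuous_id.continuousOn
  refine ⟨r₀, ⟨hr₀.1, hr₀.2.lt_of_ne ?_⟩, hr₀W, fun r hr => ?_⟩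
  · rintro rfl
    exact hr₀W h1
  · by_contra hrW
    exact (hmax ⟨⟨hr₀.1.trans hr.1.le, hr.2⟩, hrW⟩).not_gt hr.1

lemma exists_mem_frontier_sub_le (hH : IsHamiltonian H) (hs : 0 ≤ s) (hW : IsOpen W)
    (hu : LipschitzOnWith K u W) (hcont : ContinuousOn u (closure W))
    (hgrad : ∀ᵐ y, y ∈ W → H (gradient u y) ≤ s) {x z : EuclideanSpace ℝ (Fin n)}
    (hx : x ∈ W) (hz : z ∉ W) :
    ∃ r ∈ Icc (0 : ℝ) 1, z + r • (x - z) ∈ frontier W ∧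
      u x - u (z + r • (x - z)) ≤ (1 - r) * cone H s (x - z) := by
  set ray : ℝ → EuclideanSpace ℝ (Fin n) := fun r => z + r • (x - z)
  have hray : Continuous ray := by fun_prop
  obtain ⟨r₀, hr₀, hr₀W, hrW⟩ := exists_last_exit hW hray (by simpa [ray]) (by simpa [ray])
  have hlimW : Tendsto ray (𝓝[>] r₀) (𝓝[closure W] ray r₀) := by
    refine tendsto_nhdsWithin_iff.2 ⟨hray.continuousAt.tendsto.mono_left nhdsWithin_le_nhds, ?_⟩
    filter_upwards [Ioo_mem_nhdsGT hr₀.2] with r hr using subset_closure (hrW r ⟨hr.1, hr.2.le⟩)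
  have hcl : ray r₀ ∈ closure W :=
    isClosed_closure.mem_of_tendsto (hlimW.mono_right nhdsWithin_le_nhds)
      (hlimW.eventually self_mem_nhdsWithin)
  have hbound : ∀ r ∈ Ioo r₀ 1, u x - u (ray r) ≤ (1 - r) * cone H s (x - z) := fun r hr => by
    have hseg : ∀ a ∈ Icc (0 : ℝ) 1, ray r + a • (1 - r) • (x - z) ∈ W := fun a ha => by
      have : ray r + a • (1 - r) • (x - z) = ray (r + a * (1 - r)) := by
        simp only [ray]
        module
      rw [this]
      exact hrW _ ⟨by nlinarith [ha.1, hr.1, hr.2], by nlinarith [ha.2, hr.2]⟩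
    have hsub := sub_le_cone_of_ae_map_gradient_le hH hW hu hgrad hseg
    have hend : ray r + (1 - r) • (x - z) = x := by
      simp only [ray]
      module
    rwa [hend, hH.cone_smul hs (by linarith [hr.2])] at hsub
  refine ⟨r₀, Ico_subset_Icc_self hr₀, by rw [hW.frontier_eq]; exact ⟨hcl, hr₀W⟩, ?_⟩
  have hlim : Tendsto (fun r : ℝ => (1 - r) * cone H s (x - z)) (𝓝[>] r₀)
      (𝓝 ((1 - r₀) * cone H s (x - z))) :=
    (Continuous.tendsto (by fun_prop) r₀).mono_left nhdsWithin_le_nhds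
  refine le_of_tendsto_of_tendsto (tendsto_const_nhds.sub ((hcont _ hcl).tendsto.comp hlimW))
    hlim ?_
  filter_upwards [Ioo_mem_nhdsGT hr₀.2] with r hr using hbound r hr

lemma AbsSubminimizing.comparisonWithCones (hH : IsHamiltonian H) (hU : IsOpen U)
    (hu : AbsSubminimizing H U u) : ComparisonWithCones H U u := by
  intro V hV s hs z b hfr hz x hx
  by_contra! hlt
  have hcu := hu.1.continuousOn hU
  set φ : EuclideanSpace ℝ (Fin n) → ℝ := fun y => cone H s (y - z) + b with hφ
  obtain ⟨K, hK⟩ : ∃ K, LipschitzWith K φ := by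
    obtain ⟨K, hK⟩ := hH.exists_lipschitzWith_cone hs
    refine ⟨K, LipschitzWith.of_dist_le_mul fun y y' => ?_⟩
    simpa [hφ] using hK.dist_le_mul (y - z) (y' - z)
  set W := {y ∈ V | φ y < u y}
  have hW : CompactlyInside W U := hV.mono
    (isOpen_sep_lt hV.1 (hcu.mono (subset_closure.trans hV.2.2)) hK.continuous) (sep_subset _ _)
  have hcomp : Competitor W u φ := competitor_sep_lt hV hcu hK hfr
  have hgrad := hu.ae_map_gradient_le hW hcomp (fun y hy => hy.2.le)
    (hH.map_gradient_cone_le hs z b)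
  have hzW : z ∉ W := fun hzW => by
    have := hzW.2
    simp only [hφ, sub_self, hH.cone_zero hs] at this
    linarith [hz hzW.1]
  obtain ⟨L, hL⟩ := hu.1 W hW
  obtain ⟨r, hr, hrW, hle⟩ := exists_mem_frontier_sub_le hH hs hW.1 hL (hcu.mono hW.2.2) hgrad
    (show x ∈ W from ⟨hx, hlt⟩) hzW
  have hφr : cone H s (r • (x - z)) + b = u (z + r • (x - z)) := by
    simpa [hφ] using hcomp.2.2 hrW
  rw [hH.cone_smul hs hr.1] at hφr
  linarith

lemma gradient_neg (x : EuclideanSpace ℝ (Fin n)) :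
    gradient (fun y => -u y) x = -gradient u x := by
  simp [gradient, fderiv_fun_neg]

lemma supH_neg (V : Set (EuclideanSpace ℝ (Fin n))) :
    supH (fun p => H (-p)) V (fun y => -u y) = supH H V u := by
  simp [supH, gradient_neg]

lemma LipLoc.neg (hu : LipLoc U u) : LipLoc U fun y => -u y := fun V hV =>
  let ⟨K, hK⟩ := hu V hV
  ⟨K, hK.neg⟩

lemma Competitor.neg (hv : Competitor V u v) : Competitor V (fun y => -u y) fun y => -v y :=
  ⟨hv.1.neg, hv.2.1.neg, fun _ hy => congrArg Neg.neg (hv.2.2 hy)⟩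

lemma AbsSuperminimizing.neg (hu : AbsSuperminimizing H U u) :
    AbsSubminimizing (fun p => H (-p)) U fun y => -u y := by
  refine ⟨hu.1.neg, fun V hV w hw hwu => ?_⟩
  have := hu.2 V hV (fun y => -w y) (by simpa using hw.neg) fun x hx => by linarith [hwu x hx]
  rw [← supH_neg, ← supH_neg (u := fun y => -w y)] at this
  simpa using this

lemma AbsMinimizing.absSubminimizing (hu : AbsMinimizing H U u) : AbsSubminimizing H U u :=
  ⟨hu.1, fun V hV v hv _ => hu.2 V hV v hv⟩

lemma AbsMinimizing.absSuperminimizing (hu : AbsMinimizing H U u) : AbsSuperminimizing H U u :=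
  ⟨hu.1, fun V hV v hv _ => hu.2 V hV v hv⟩

end ComparisonWithCones

section ConvexityCriterion

variable {E : Type*} [NormedAddCommGroup E] [InnerProductSpace ℝ E] {H : E → ℝ}
  {k s S t τ : ℝ} {w : E}

/-- The displacements for which some slope below `k` beats `k` in the problem of maximizing
`cone H s w - τ * s` over `s ≥ 0`, whose value is the cost of `w` in time `τ`. -/
def lowSlopeSet (H : E → ℝ) (k τ : ℝ) : Set E :=
  {w | ∃ s ∈ Ico 0 k, cone H k w - τ * k < cone H s w - τ * s}

lemma cone_sub_le_of_notMem_lowSlopeSet (hw : w ∉ lowSlopeSet H k τ) (hs : 0 ≤ s) (hsk : s ≤ k) :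
    cone H s w - τ * s ≤ cone H k w - τ * k := by
  rcases hsk.eq_or_lt with rfl | hlt
  · exact le_rfl
  · exact not_lt.1 fun h => hw ⟨s, ⟨hs, hlt⟩, h⟩

namespace IsHamiltonian

variable [FiniteDimensional ℝ E]

lemma concaveOn_cone_sub (hH : IsHamiltonian H) (τ : ℝ) (w : E) :
    ConcaveOn ℝ (Ici 0) fun s => cone H s w - τ * s := by
  have hlin : ConvexOn ℝ (Ici 0) fun s : ℝ => τ * s :=
    (LinearMap.mulLeft ℝ τ).convexOn (convex_Ici 0)
  exact (hH.concaveOn_cone w).sub hlin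

lemma isOpen_lowSlopeSet (hH : IsHamiltonian H) (hk : 0 ≤ k) : IsOpen (lowSlopeSet H k τ) := by
  have : lowSlopeSet H k τ = ⋃ s ∈ Ico 0 k, {w | cone H k w - τ * k < cone H s w - τ * s} := by
    ext w
    simp [lowSlopeSet]
  rw [this]
  refine isOpen_biUnion fun s hs => ?_
  have := hH.continuous_cone hk
  have := hH.continuous_cone hs.1
  exact isOpen_lt (by fun_prop) (by fun_prop)

lemma cone_sub_anti_of_mem_lowSlopeSet (hH : IsHamiltonian H) (hw : w ∈ lowSlopeSet H k τ)
    {r : ℝ} (hkr : k ≤ r) (hrs : r ≤ s) : cone H s w - τ * s ≤ cone H r w - τ * r := by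
  obtain ⟨q, ⟨hq, hqk⟩, hlt⟩ := hw
  have hconc := hH.concaveOn_cone_sub τ w
  have hk : 0 ≤ k := hq.trans hqk.le
  have hr : cone H r w - τ * r ≤ cone H k w - τ * k :=
    hconc.right_le_of_le_left'' hq (hk.trans hkr) hqk hkr hlt.le
  exact hconc.right_le_of_le_left'' hq (hk.trans (hkr.trans hrs)) (hqk.trans_le hkr) hrs
    (hr.trans hlt.le)

lemma lowSlopeSet_subset_closedBall (hH : IsHamiltonian H) (hτ : 0 ≤ τ) {r : ℝ} (hr : 0 ≤ r)
    (hkr : k ≤ r) (hrS : r ≤ S) (hgap : ∀ w, cone H r w + ‖w‖ ≤ cone H S w) :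
    lowSlopeSet H k τ ⊆ closedBall 0 (τ * S) := by
  intro w hw
  rw [mem_closedBall_zero_iff]
  linarith [hgap w, hH.cone_sub_anti_of_mem_lowSlopeSet hw hkr hrS, mul_nonneg hτ hr]

lemma cost_le_of_mem_frontier_lowSlopeSet (hH : IsHamiltonian H) (hk : 0 ≤ k) (hS : 0 ≤ S)
    (hτ : 0 ≤ τ) (hw : w ∈ frontier (lowSlopeSet H k τ)) :
    cost H S τ w ≤ cone H k w - τ * k := by
  rw [(hH.isOpen_lowSlopeSet hk).frontier_eq] at hw
  obtain ⟨s, hs, h⟩ := hH.exists_cost_eq_cone_sub hS hτ w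
  rw [h]
  rcases le_total s k with hsk | hks
  · exact cone_sub_le_of_notMem_lowSlopeSet hw.2 hs.1 hsk
  · have hclosed : IsClosed {w | cone H s w - τ * s ≤ cone H k w - τ * k} := by
      have := hH.continuous_cone hk
      have := hH.continuous_cone hs.1
      exact isClosed_le (by fun_prop) (by fun_prop)
    exact closure_minimal (fun w hw => hH.cone_sub_anti_of_mem_lowSlopeSet hw le_rfl hks)
      hclosed hw.1

lemma cost_add_le_of_notMem_lowSlopeSet (hH : IsHamiltonian H) (hk : 0 ≤ k) (hkS : k ≤ S)
    (ht : 0 ≤ t) (htτ : t ≤ τ) (hw : w ∉ lowSlopeSet H k τ) :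
    cost H S τ w + (τ - t) * k ≤ cost H S t w := by
  obtain ⟨s, hs, h⟩ := hH.exists_cost_eq_cone_sub (hk.trans hkS) (ht.trans htτ) w
  rw [h]
  rcases le_total s k with hsk | hks
  · linarith [cone_sub_le_of_notMem_lowSlopeSet hw hs.1 hsk, hH.cone_sub_le_cost hk hkS ht w]
  · linarith [hH.cone_sub_le_cost hs.1 hs.2 ht w,
      mul_le_mul_of_nonneg_left hks (sub_nonneg.2 htτ)]

end IsHamiltonian

/-- The convexity criterion: comparison with cones makes a growth bound with `cost H S τ` improve
when the time `τ` is shortened to `t`. Its excess `τ * k` over `u x` shrinks in proportion. -/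
lemma ComparisonWithCones.le_add_cost {n : ℕ} {H : EuclideanSpace ℝ (Fin n) → ℝ}
    {U : Set (EuclideanSpace ℝ (Fin n))} {u : EuclideanSpace ℝ (Fin n) → ℝ} {r : ℝ}
    (hu : ComparisonWithCones H U u) (hH : IsHamiltonian H) {x : EuclideanSpace ℝ (Fin n)}
    (hU : closedBall x (τ * S) ⊆ U) (ht : 0 ≤ t) (htτ : t ≤ τ) (hk : 0 ≤ k) (hkr : k ≤ r)
    (hrS : r ≤ S) (hgap : ∀ w, cone H r w + ‖w‖ ≤ cone H S w)
    (hbound : ∀ y ∈ U, u y ≤ u x + τ * k + cost H S τ (y - x)) :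
    ∀ y ∈ U, u y ≤ u x + t * k + cost H S t (y - x) := by
  have hτ : 0 ≤ τ := ht.trans htτ
  have hkS : k ≤ S := hkr.trans hrS
  set V := Homeomorph.subRight x ⁻¹' lowSlopeSet H k τ with hV
  have hball : V ⊆ closedBall x (τ * S) := fun y hy => by
    have := hH.lowSlopeSet_subset_closedBall hτ (hk.trans hkr) hkr hrS hgap hy
    rwa [mem_closedBall_zero_iff, Homeomorph.subRight_apply, ← mem_closedBall_iff_norm] at this
  have hclV : closure V ⊆ closedBall x (τ * S) := closure_minimal hball isClosed_closedBall
  have hVU : CompactlyInside V U :=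
    ⟨(hH.isOpen_lowSlopeSet hk).preimage (Homeomorph.subRight x).continuous,
      (isCompact_closedBall x _).of_isClosed_subset isClosed_closure hclV, hclV.trans hU⟩
  have hcone : ∀ y ∈ V, u y ≤ cone H k (y - x) + u x := by
    refine hu V hVU k hk x (u x) (fun y hy => ?_) fun _ => le_rfl
    have hyU : y ∈ U := hU (hclV (frontier_subset_closure hy))
    rw [hV, ← Homeomorph.preimage_frontier] at hy
    have := hH.cost_le_of_mem_frontier_lowSlopeSet hk (hk.trans hkS) hτ hy
    simp only [Homeomorph.subRight_apply] at this
    linarith [hbound y hyU]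
  intro y hy
  by_cases hyV : y ∈ V
  · linarith [hcone y hyV, hH.cone_sub_le_cost hk hkS ht (y - x)]
  · have hyx : y - x ∉ lowSlopeSet H k τ := hyV
    linarith [hbound y hy, hH.cost_add_le_of_notMem_lowSlopeSet hk hkS ht htτ hyx]

end ConvexityCriterion

section SupConvolution

/-- The sup-convolution of `u` with the cost of moving in time `t`, over moves of length at most
`ρ`. -/
def supConv {E : Type*} [NormedAddCommGroup E] [InnerProductSpace ℝ E] (H : E → ℝ) (S t ρ : ℝ)
    (u : E → ℝ) (x : E) : ℝ :=
  sSup ((fun y => u y - cost H S t (y - x)) '' closedBall x ρ)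

/-- The inner parallel set of `U` at distance `ρ`. -/
def erosion {E : Type*} [PseudoMetricSpace E] (U : Set E) (ρ : ℝ) : Set E :=
  {x | closedBall x ρ ⊆ U}

lemma erosion_subset {E : Type*} [PseudoMetricSpace E] {U : Set E} {ρ : ℝ} (hρ : 0 ≤ ρ) :
    erosion U ρ ⊆ U :=
  fun _ hx => hx (mem_closedBall_self hρ)

/-- The cost of moving from `x` to `y` in time `t`, as a cost for the finite difference equation on
a subset of `E`. -/
def stepCost {E : Type*} [NormedAddCommGroup E] [InnerProductSpace ℝ E] (H : E → ℝ) (S t : ℝ)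
    {X : Set E} (x y : X) : ℝ :=
  cost H S t (y - x)

variable {E : Type*} [NormedAddCommGroup E] [InnerProductSpace ℝ E] {H : E → ℝ} {K : NNReal}
  {ρ k S t a : ℝ} {u : E → ℝ} {U X : Set E} {x y : E}

lemma stepCost_comp_neg :
    stepCost (fun p => H (-p)) S t (X := X) = flip (stepCost H S t) := by
  ext x y
  simp [stepCost, flip, cost_comp_neg]

lemma supConv_le (hρ : 0 ≤ ρ) (h : ∀ y ∈ closedBall x ρ, u y ≤ a + cost H S t (y - x)) :
    supConv H S t ρ u x ≤ a := by
  refine csSup_le ((nonempty_closedBall.2 hρ).image _) ?_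
  rintro _ ⟨y, hy, rfl⟩
  linarith [h y hy]

variable [FiniteDimensional ℝ E]

lemma le_supConv (hH : IsHamiltonian H) (hS : 0 ≤ S) (hu : ContinuousOn u (closedBall x ρ))
    (hy : y ∈ closedBall x ρ) : u y - cost H S t (y - x) ≤ supConv H S t ρ u x := by
  obtain ⟨B, hB⟩ := (isCompact_closedBall x ρ).bddAbove_image hu
  refine le_csSup ⟨B, ?_⟩ ⟨y, hy, rfl⟩
  rintro _ ⟨z, hz, rfl⟩
  linarith [hB ⟨z, hz, rfl⟩, hH.cost_nonneg hS t (z - x)]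

lemma self_le_supConv (hH : IsHamiltonian H) (hS : 0 ≤ S) (ht : 0 ≤ t) (hρ : 0 ≤ ρ)
    (hu : ContinuousOn u (closedBall x ρ)) : u x ≤ supConv H S t ρ u x := by
  simpa [hH.cost_zero hS ht] using le_supConv (t := t) hH hS hu (mem_closedBall_self hρ)

lemma supConv_le_add_mul (hH : IsHamiltonian H) (hS : 0 ≤ S) (hρ : 0 ≤ ρ)
    (hu : LipschitzOnWith K u U) (hx : x ∈ erosion U ρ) :
    supConv H S t ρ u x ≤ u x + K * ρ := by
  refine supConv_le hρ fun y hy => ?_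
  have hK : K * dist y x ≤ K * ρ := mul_le_mul_of_nonneg_left hy K.coe_nonneg
  linarith [hu.le_add_mul (hx hy) (erosion_subset hρ hx), hH.cost_nonneg hS t (y - x)]

lemma IsAdmissibleScale.le_add_cost (hsc : IsAdmissibleScale H K ρ k S t) (hH : IsHamiltonian H)
    (hu : LipschitzOnWith K u U) (hx : x ∈ U) (hy : y ∈ U) :
    u y ≤ u x + t * k + cost H S t (y - x) := by
  have := hH.mul_norm_le_cost K.coe_nonneg hsc.map_le hsc.level_le hsc.time_pos.le (y - x)
  rw [← dist_eq_norm] at this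
  linarith [hu.le_add_mul hy hx]

lemma IsAdmissibleScale.supConv_le_add (hsc : IsAdmissibleScale H K ρ k S t)
    (hH : IsHamiltonian H) (hρ : 0 ≤ ρ) (hu : LipschitzOnWith K u U) (hx : x ∈ erosion U ρ) :
    supConv H S t ρ u x ≤ u x + t * k :=
  supConv_le hρ fun _ hy => hsc.le_add_cost hH hu (erosion_subset hρ hx) (hx hy)

lemma isBounded_range_supConv (hH : IsHamiltonian H) (hS : 0 ≤ S) (ht : 0 ≤ t) (hρ : 0 ≤ ρ)
    (hu : LipschitzOnWith K u U) (hU : IsBounded U) :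
    IsBounded (range fun x : erosion U ρ => supConv H S t ρ u x) := by
  obtain ⟨v, hv, huv⟩ := hu.extend_real
  obtain ⟨B, hB⟩ := (huv.image_eq ▸ hv.isBounded_image hU).exists_norm_le
  refine isBounded_iff_forall_norm_le.2 ⟨B + K * ρ, ?_⟩
  rintro _ ⟨⟨x, hx⟩, rfl⟩
  have hux := abs_le.1 (hB (u x) ⟨x, erosion_subset hρ hx, rfl⟩)
  have hlow := self_le_supConv hH hS ht hρ (hu.continuousOn.mono hx)
  have hKρ : 0 ≤ K * ρ := by positivity
  exact abs_le.2 ⟨by linarith, by linarith [supConv_le_add_mul hH hS hρ hu hx (t := t)]⟩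

/-- Two half moves: the first is paid for by the gain of the sup-convolution, the second by the
sup-convolution itself. -/
lemma le_supConv_add_gain_add_cost (hH : IsHamiltonian H) (hS : 0 ≤ S) (ht : 0 ≤ t) (hρ : 0 ≤ ρ)
    (hu : LipschitzOnWith K u U) (hU : IsBounded U) {x : erosion U ρ}
    (hx : x.1 ∈ erosion (erosion U ρ) ρ) (hy : y ∈ closedBall x.1 (2 * ρ)) :
    y ∈ U ∧ u y ≤ supConv H S t ρ u x + gain (fun x y : erosion U ρ => dist x y ≤ ρ)
      (stepCost H S t) (fun x => supConv H S t ρ u x) x + cost H S (2 * t) (y - x) := by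
  set m : E := x + (2⁻¹ : ℝ) • (y - x) with hm
  have hxm : m - x = (2⁻¹ : ℝ) • (y - x) := add_sub_cancel_left _ _
  have hmy : y - m = (2⁻¹ : ℝ) • (y - x) := by
    rw [hm]
    module
  have hnorm : ‖(2⁻¹ : ℝ) • (y - x)‖ ≤ ρ := by
    rw [mem_closedBall_iff_norm] at hy
    rw [norm_smul, Real.norm_of_nonneg (by norm_num)]
    linarith
  have hmU : m ∈ erosion U ρ := hx (by rwa [mem_closedBall_iff_norm, hxm])
  have hym : y ∈ closedBall m ρ := by rwa [mem_closedBall_iff_norm, hmy]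
  refine ⟨hmU hym, ?_⟩
  have hfirst := le_gain (N := fun x y : erosion U ρ => dist x y ≤ ρ) (c := stepCost H S t)
    (fun x y => hH.cost_nonneg hS t _)
    (isBounded_range_supConv hH hS ht hρ hu hU).bddAbove (x := x) (y := ⟨m, hmU⟩)
    (by rwa [dist_comm, Subtype.dist_eq, dist_eq_norm, hxm])
  have hsecond := le_supConv (t := t) hH hS (hu.continuousOn.mono hmU) hym
  have htwo : cost H S (2 * t) (y - x) = 2 * cost H S t ((2⁻¹ : ℝ) • (y - x)) := by
    rw [← hH.cost_smul hS zero_le_two, smul_inv_smul₀ two_ne_zero]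
  simp only [stepCost, hxm] at hfirst
  rw [hmy] at hsecond
  linarith

end SupConvolution

section DiscreteSubsolution

variable {n : ℕ} {H : EuclideanSpace ℝ (Fin n) → ℝ} {U V : Set (EuclideanSpace ℝ (Fin n))}
  {u : EuclideanSpace ℝ (Fin n) → ℝ} {K : NNReal} {ρ k S t : ℝ}

lemma ComparisonWithCones.mono (hu : ComparisonWithCones H U u) (hVU : V ⊆ U) :
    ComparisonWithCones H V u :=
  fun W hW => hu W ⟨hW.1, hW.2.1, hW.2.2.trans hVU⟩

lemma ComparisonWithCones.isDiscreteSubsolution_supConv (hu : ComparisonWithCones H U u)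
    (hH : IsHamiltonian H) (hsc : IsAdmissibleScale H K ρ k S t) (hρ : 0 ≤ ρ)
    (hLip : LipschitzOnWith K u U) (hU : IsBounded U) :
    IsDiscreteSubsolution (fun x y : erosion U ρ => dist x y ≤ ρ) (stepCost H S t)
      {x | x.1 ∈ erosion (erosion U ρ) ρ} fun x => supConv H S t ρ u x := by
  intro x hx
  have hS := hsc.top_nonneg hH
  have ht := hsc.time_pos
  have hN : ∀ x : erosion U ρ, dist x x ≤ ρ := fun x => by rwa [dist_self]
  have hbound := fun y => le_supConv_add_gain_add_cost hH hS ht.le hρ hLip hU hx (y := y)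
  set f : erosion U ρ → ℝ := fun x => supConv H S t ρ u x with hf
  set G := gain (fun x y : erosion U ρ => dist x y ≤ ρ) (stepCost H S t) f x
  obtain ⟨l, hl⟩ : ∃ l, f x + G = u x + 2 * t * l :=
    ⟨(f x + G - u x) / (2 * t), by field_simp; ring⟩
  have hl0 : 0 ≤ l := by
    have := (hbound x (mem_closedBall_self (by positivity))).2
    rw [sub_self, hH.cost_zero hS (by positivity)] at this
    exact nonneg_of_mul_nonneg_right (a := 2 * t) (by linarith) (by positivity)
  have hlk : l ≤ k := by
    have hG : G ≤ u x + 2 * t * k - f x := gain_le hN fun y _ => by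
      have hfy : f y ≤ u y + t * k := hsc.supConv_le_add hH hρ hLip y.2
      have := hsc.le_add_cost hH hLip (erosion_subset hρ x.2) (erosion_subset hρ y.2)
      simp only [stepCost]
      linarith
    exact le_of_mul_le_mul_left (a := 2 * t) (by linarith) (by positivity)
  have hball : closedBall x.1 (2 * ρ) ⊆ U := fun y hy => (hbound y hy).1
  have hcrit := (hu.mono hball).le_add_cost hH (τ := 2 * t)
    (closedBall_subset_closedBall (by linarith [hsc.time_mul_le])) ht.le (by linarith) hl0 hlk
    hsc.level_le hsc.cone_add_norm_le fun y hy => by linarith [(hbound y hy).2]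
  have hfx : f x ≤ u x + t * l := supConv_le hρ fun y hy =>
    hcrit y (closedBall_subset_closedBall (by linarith) hy)
  have hloss : loss (fun x y : erosion U ρ => dist x y ≤ ρ) (stepCost H S t) f x ≤ f x - u x :=
    loss_le hN fun z hz => by
      have := le_supConv (t := t) hH hS (hLip.continuousOn.mono z.2) hz
      simp only [hf, stepCost]
      linarith
  linarith

end DiscreteSubsolution

section Comparison

lemma compl_erosion_subset_cthickening {E : Type*} [PseudoMetricSpace E] (U : Set E) (ρ : ℝ) :
    (erosion U ρ)ᶜ ⊆ cthickening ρ Uᶜ := by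
  intro x hx
  obtain ⟨y, hyx, hyU⟩ := not_subset.1 hx
  exact mem_cthickening_of_dist_le x y ρ Uᶜ hyU (by rwa [dist_comm])

lemma compl_erosion_erosion_subset_cthickening {E : Type*} [PseudoMetricSpace E] (U : Set E)
    {ρ : ℝ} (hρ : 0 ≤ ρ) : (erosion (erosion U ρ) ρ)ᶜ ⊆ cthickening (ρ + ρ) Uᶜ :=
  (compl_erosion_subset_cthickening _ ρ).trans
    ((cthickening_subset_of_subset ρ (compl_erosion_subset_cthickening U ρ)).trans
      (cthickening_cthickening_subset hρ hρ _))

lemma exists_le_of_mem_cthickening {E : Type*} [PseudoMetricSpace E] [ProperSpace E] {U : Set E}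
    (hU : IsOpen U) (hUb : IsBounded U) {f : E → ℝ} (hf : ContinuousOn f (closure U)) {M ε : ℝ}
    (hM : ∀ y ∈ frontier U, f y ≤ M) (hε : 0 < ε) :
    ∃ δ > 0, ∀ y ∈ U, y ∈ cthickening δ Uᶜ → f y ≤ M + ε := by
  have hcpt : IsCompact (closure U ∩ f ⁻¹' Ici (M + ε)) :=
    hUb.isCompact_closure.of_isClosed_subset
      (hf.preimage_isClosed_of_isClosed isClosed_closure isClosed_Ici) inter_subset_left
  have hdisj : Disjoint (closure U ∩ f ⁻¹' Ici (M + ε)) Uᶜ := by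
    refine disjoint_left.2 fun y hy hyU => ?_
    have hfr := hM y (by rw [hU.frontier_eq]; exact ⟨hy.1, hyU⟩)
    linarith [show M + ε ≤ f y from hy.2]
  obtain ⟨δ, hδ, hδdisj⟩ := hdisj.exists_cthickenings hcpt hU.isClosed_compl
  refine ⟨δ, hδ, fun y hy hyδ => ?_⟩
  by_contra! hlt
  exact disjoint_left.1 hδdisj (self_subset_cthickening _ ⟨subset_closure hy, hlt.le⟩) hyδ

lemma compactlyInside_compl_cthickening {n : ℕ} {U : Set (EuclideanSpace ℝ (Fin n))}
    (hUb : IsBounded U) {r : ℝ} (hr : 0 < r) : CompactlyInside (cthickening r Uᶜ)ᶜ U := by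
  have hcl : closure (cthickening r Uᶜ)ᶜ ⊆ U := by
    rw [closure_compl, compl_subset_comm]
    calc Uᶜ ⊆ thickening r Uᶜ := self_subset_thickening hr _
      _ ⊆ interior (cthickening r Uᶜ) := thickening_subset_interior_cthickening r _
  exact ⟨isClosed_cthickening.isOpen_compl,
    isCompact_of_isClosed_isBounded isClosed_closure (hUb.subset hcl), hcl⟩

lemma floor_sub_inner_lt {E : Type*} [NormedAddCommGroup E] [InnerProductSpace ℝ E] {e x : E}
    {η R : ℝ} (he : ‖e‖ = 1) (hη : 0 < η) (hx : ‖x + η • e‖ ≤ R) :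
    ⌊(R - inner ℝ (x + η • e) e) / η⌋₊ < ⌊(R - inner ℝ x e) / η⌋₊ := by
  have hle : 0 ≤ (R - inner ℝ (x + η • e) e) / η := by
    refine div_nonneg (sub_nonneg.2 ((real_inner_le_norm _ _).trans ?_)) hη.le
    rwa [he, mul_one]
  have hstep : (R - inner ℝ x e) / η = (R - inner ℝ (x + η • e) e) / η + 1 := by
    rw [inner_add_left, real_inner_smul_left, real_inner_self_eq_norm_sq, he]
    field_simp
    ring
  rw [hstep, Nat.floor_add_one hle]
  exact Nat.lt_succ_self _

variable {n : ℕ} {H : EuclideanSpace ℝ (Fin n) → ℝ} {U : Set (EuclideanSpace ℝ (Fin n))}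
  {u v w : EuclideanSpace ℝ (Fin n) → ℝ} {K : NNReal} {M ε ρ S t : ℝ}
  {x e : EuclideanSpace ℝ (Fin n)}

/-- The height `h x` bounds the number of steps of length `η` along `e` that stay inside a ball
containing `U`; the ratio of the cost to `η` tends to `0` with `η`. -/
lemma exists_escape (hH : IsHamiltonian H) (he1 : ‖e‖ = 1)
    (he : ∀ p, H p = 0 → inner ℝ p e = 0) (hS : 0 ≤ S) (ht : 0 < t) (hρ : 0 < ρ)
    (hU : IsBounded U) (hε : 0 < ε) :
    ∃ (κ : ℝ) (h : erosion U ρ → ℕ) (J : ℕ), 0 ≤ κ ∧ J * κ ≤ ε ∧ (∀ x, h x ≤ J) ∧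
      ∀ x : erosion U ρ, x.1 ∈ erosion (erosion U ρ) ρ → ∃ y : erosion U ρ, dist x y ≤ ρ ∧
        h y < h x ∧ stepCost H S t x y + stepCost H S t y x ≤ κ := by
  obtain ⟨R, hR, hUR⟩ := hU.exists_pos_norm_le
  obtain ⟨η₀, hη₀, hcost⟩ := hH.exists_cost_smul_le he hS ht (show 0 < ε / (4 * R) by positivity)
  set η := min η₀ ρ
  have hη : 0 < η := lt_min hη₀ hρ
  have hnorm : ∀ x : erosion U ρ, ‖x.1‖ ≤ R := fun x => hUR x (erosion_subset hρ.le x.2)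
  refine ⟨2 * (η * (ε / (4 * R))), fun x => ⌊(R - inner ℝ x.1 e) / η⌋₊, ⌊2 * R / η⌋₊,
    by positivity, ?_, fun x => ?_, fun x hx => ?_⟩
  · calc (⌊2 * R / η⌋₊ : ℝ) * (2 * (η * (ε / (4 * R))))
        ≤ 2 * R / η * (2 * (η * (ε / (4 * R)))) := by
          gcongr
          exact Nat.floor_le (by positivity)
      _ = ε := by field_simp; norm_num
  · have hinner := (abs_real_inner_le_norm x.1 e).trans_eq (by rw [he1, mul_one])
    refine Nat.floor_le_floor (div_le_div_of_nonneg_right ?_ hη.le)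
    linarith [(abs_le.1 hinner).1, hnorm x]
  · have hstep : dist x.1 (x.1 + η • e) ≤ ρ := by
      rw [dist_self_add_right, norm_smul, he1, mul_one, Real.norm_of_nonneg hη.le]
      exact min_le_right _ _
    have hmem : x.1 + η • e ∈ erosion U ρ := hx (by rwa [mem_closedBall, dist_comm])
    refine ⟨⟨_, hmem⟩, hstep, floor_sub_inner_lt he1 hη (hnorm ⟨_, hmem⟩), ?_⟩
    have hforth := hcost η (by rw [abs_of_pos hη]; exact min_le_left _ _)
    have hback := hcost (-η) (by rw [abs_neg, abs_of_pos hη]; exact min_le_left _ _)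
    rw [abs_neg] at hback
    rw [abs_of_pos hη] at hforth hback
    have hdiff : x.1 - (x.1 + η • e) = -η • e := by module
    simp only [stepCost, add_sub_cancel_left, hdiff]
    linarith

/-- A subsolution `u` for `H` and a subsolution `w` for `p ↦ H (-p)` play the roles of `u` and `-v`
in the comparison of `u` with a supersolution `v`. -/
lemma add_le_of_lipschitzOnWith (hH : IsHamiltonian H) (hint : interior {p | H p = 0} = ∅)
    (hU : IsBounded U) (hu : LipschitzOnWith K u U) (hw : LipschitzOnWith K w U)
    (hcu : ComparisonWithCones H U u) (hcw : ComparisonWithCones (fun p => H (-p)) U w)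
    (hρ : 0 < ρ) (hM : ∀ x ∈ U, x ∉ erosion (erosion U ρ) ρ → u x + w x ≤ M) (hx : x ∈ U) :
    u x + w x ≤ M + 2 * (K * ρ) := by
  have hKρ : 0 ≤ K * ρ := by positivity
  by_cases hxρ : x ∈ erosion U ρ
  swap
  · linarith [hM x hx fun hxρρ => hxρ (erosion_subset hρ.le hxρρ)]
  obtain ⟨k, S, t, hsc⟩ := hH.exists_isAdmissibleScale K hρ
  have hS := hsc.top_nonneg hH
  have ht := hsc.time_pos
  obtain ⟨e, he1, he⟩ :=
    exists_unit_orthogonal_of_interior_eq_empty hH.convex_zeros hH.map_zero hint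
  set f : erosion U ρ → ℝ := fun y => supConv H S t ρ u y
  set g : erosion U ρ → ℝ := fun y => supConv (fun p => H (-p)) S t ρ w y
  have hgD : IsDiscreteSubsolution (fun x y => dist x y ≤ ρ) (flip (stepCost H S t))
      {x | x.1 ∈ erosion (erosion U ρ) ρ} g := by
    rw [← stepCost_comp_neg]
    exact hcw.isDiscreteSubsolution_supConv hH.comp_neg hsc.comp_neg hρ.le hw hU
  have hfrontier : ∀ y ∉ {x : erosion U ρ | x.1 ∈ erosion (erosion U ρ) ρ},
      f y + g y ≤ M + 2 * (K * ρ) := fun y hy => by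
    linarith [hM y (erosion_subset hρ.le y.2) hy, supConv_le_add_mul hH hS hρ.le hu y.2 (t := t),
      supConv_le_add_mul hH.comp_neg hS hρ.le hw y.2 (t := t)]
  refine le_of_forall_pos_le_add fun ε hε => ?_
  obtain ⟨κ, h, J, hκ, hJκ, hJ, hh⟩ := exists_escape hH he1 he hS ht hρ hU hε
  have hfg := IsDiscreteSubsolution.add_le (N := fun x y => dist x y ≤ ρ)
    (fun y => (dist_self y).trans_le hρ.le) (fun y z hyz => by rwa [dist_comm])
    (fun y z => hH.cost_nonneg hS t _)
    (isBounded_range_supConv hH hS ht.le hρ.le hu hU)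
    (isBounded_range_supConv hH.comp_neg hS ht.le hρ.le hw hU)
    (hcu.isDiscreteSubsolution_supConv hH hsc hρ.le hu hU) hgD hκ hJ hh hfrontier ⟨x, hxρ⟩
  linarith [self_le_supConv hH hS ht.le hρ.le (hu.continuousOn.mono hxρ),
    self_le_supConv hH.comp_neg hS ht.le hρ.le (hw.continuousOn.mono hxρ)]

lemma add_le_of_comparisonWithCones (hH : IsHamiltonian H) (hint : interior {p | H p = 0} = ∅)
    (hU : IsOpen U) (hUb : IsBounded U) (hu : LipLoc U u) (hw : LipLoc U w)
    (hcu : ComparisonWithCones H U u) (hcw : ComparisonWithCones (fun p => H (-p)) U w)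
    (huw : ContinuousOn (fun y => u y + w y) (closure U)) (hM : ∀ y ∈ frontier U, u y + w y ≤ M)
    (hx : x ∈ U) : u x + w x ≤ M := by
  suffices h : ∀ ε > 0, u x + w x ≤ M + ε + 2 * ε from
    le_of_forall_pos_le_add fun ε hε => by linarith [h (ε / 3) (by positivity)]
  intro ε hε
  obtain ⟨δ, hδ, hMδ⟩ := exists_le_of_mem_cthickening hU hUb huw hM hε
  set V := (cthickening (δ / 3) Uᶜ)ᶜ with hV
  have hVU : CompactlyInside V U := compactlyInside_compl_cthickening hUb (by positivity)
  have hsub : V ⊆ U := subset_closure.trans hVU.2.2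
  by_cases hxV : x ∈ V
  swap
  · linarith [hMδ x hx (cthickening_mono (by linarith) _ (not_notMem.1 hxV))]
  obtain ⟨K₁, hK₁⟩ := hu V hVU
  obtain ⟨K₂, hK₂⟩ := hw V hVU
  set K := max K₁ K₂
  obtain ⟨ρ, hρ, hρδ, hKρ⟩ : ∃ ρ > 0, ρ ≤ δ / 3 ∧ K * ρ ≤ ε := by
    refine ⟨min (δ / 3) (ε / (K + 1)), by positivity, min_le_left _ _, ?_⟩
    calc K * min (δ / 3) (ε / (K + 1)) ≤ (K + 1) * (ε / (K + 1)) := by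
          gcongr
          · linarith
          · exact min_le_right _ _
      _ = ε := by field_simp
  have hnear : ∀ y ∈ V, y ∉ erosion (erosion V ρ) ρ → u y + w y ≤ M + ε := fun y hy hyρ => by
    refine hMδ y (hsub hy) ?_
    have := compl_erosion_erosion_subset_cthickening V hρ.le hyρ
    rw [hV, compl_compl] at this
    exact cthickening_mono (by linarith) _
      (cthickening_cthickening_subset (by positivity) (by positivity) _ this)
  have := add_le_of_lipschitzOnWith hH hint (hUb.subset hsub) (hK₁.weaken (le_max_left _ _))
    (hK₂.weaken (le_max_right _ _)) (hcu.mono hsub) (hcw.mono hsub) hρ hnear hxV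
  linarith

lemma AbsSubminimizing.sub_le (hu : AbsSubminimizing H U u) (hv : AbsSuperminimizing H U v)
    (hH : IsHamiltonian H) (hint : interior {p | H p = 0} = ∅) (hU : IsOpen U) (hUb : IsBounded U)
    (huc : ContinuousOn u (closure U)) (hvc : ContinuousOn v (closure U))
    (hM : ∀ y ∈ frontier U, u y - v y ≤ M) (hx : x ∈ U) : u x - v x ≤ M := by
  simp only [sub_eq_add_neg] at hM ⊢
  exact add_le_of_comparisonWithCones hH hint hU hUb hu.1 hv.1.neg
    (hu.comparisonWithCones hH hU) (hv.neg.comparisonWithCones hH.comp_neg hU)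
    (huc.add hvc.neg) hM hx

lemma AbsSubminimizing.exists_isMaxOn_frontier (hu : AbsSubminimizing H U u)
    (hv : AbsSuperminimizing H U v) (hH : IsHamiltonian H) (hint : interior {p | H p = 0} = ∅)
    (hU : IsOpen U) (hUb : IsBounded U) (huc : ContinuousOn u (closure U))
    (hvc : ContinuousOn v (closure U)) (hx : x ∈ U) :
    ∃ y ∈ frontier U, IsMaxOn (fun z => u z - v z) (frontier U) y ∧ u x - v x ≤ u y - v y := by
  have hcpt : IsCompact (frontier U) :=
    hUb.isCompact_closure.of_isClosed_subset isClosed_frontier frontier_subset_closure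
  have hne : (frontier U).Nonempty := by
    by_contra hempty
    have := hu.sub_le hv hH hint hU hUb huc hvc (M := u x - v x - 1)
      (fun y hy => (hempty ⟨y, hy⟩).elim) hx
    linarith
  obtain ⟨y, hy, hmax⟩ := hcpt.exists_isMaxOn hne ((huc.sub hvc).mono frontier_subset_closure)
  exact ⟨y, hy, hmax, hu.sub_le hv hH hint hU hUb huc hvc (fun z hz => hmax hz) hx⟩

lemma AbsMinimizing.le_of_eqOn_frontier (hu : AbsMinimizing H U u) (hv : AbsMinimizing H U v)
    (hH : IsHamiltonian H) (hint : interior {p | H p = 0} = ∅) (hU : IsOpen U) (hUb : IsBounded U)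
    (huc : ContinuousOn u (closure U)) (hvc : ContinuousOn v (closure U))
    (huv : EqOn u v (frontier U)) (hx : x ∈ closure U) : u x ≤ v x := by
  by_cases hxU : x ∈ U
  · exact sub_nonpos.1 (hu.absSubminimizing.sub_le hv.absSuperminimizing hH hint hU hUb huc hvc
      (fun y hy => (sub_eq_zero.2 (huv hy)).le) hxU)
  · exact (huv (by rw [hU.frontier_eq]; exact ⟨hx, hxU⟩)).le

end Comparison

end

theorem theorem2p1 (n : ℕ) (H : EuclideanSpace ℝ (Fin n) → ℝ)
    (hconv : ConvexOn ℝ Set.univ H)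
    (hzero : H 0 = 0) (hmin : ∀ p, 0 ≤ H p)
    (hbdd : Bornology.IsBounded {p | H p = 0})
    (hint : interior {p | H p = 0} = ∅)
    (U : Set (EuclideanSpace ℝ (Fin n))) (hU : IsOpen U) (hUb : Bornology.IsBounded U) :
    (∀ u v : EuclideanSpace ℝ (Fin n) → ℝ,
      ContinuousOn u (closure U) → ContinuousOn v (closure U) →
      AbsSubminimizing H U u → AbsSuperminimizing H U v →
      ∀ x ∈ U, ∃ y ∈ frontier U,
        IsMaxOn (fun z => u z - v z) (frontier U) y ∧ u x - v x ≤ u y - v y) ∧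
    (∀ u v : EuclideanSpace ℝ (Fin n) → ℝ,
      ContinuousOn u (closure U) → ContinuousOn v (closure U) →
      AbsMinimizing H U u → AbsMinimizing H U v →
      Set.EqOn u v (frontier U) → Set.EqOn u v (closure U)) := by
  have hH : IsHamiltonian H := ⟨hconv, hzero, hmin, hbdd⟩
  refine ⟨fun u v huc hvc hu hv x hx => hu.exists_isMaxOn_frontier hv hH hint hU hUb huc hvc hx,
    fun u v huc hvc hu hv huv x hx => le_antisymm ?_ ?_⟩
  · exact hu.le_of_eqOn_frontier hv hH hint hU hUb huc hvc huv hx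
  · exact hv.le_of_eqOn_frontier hu hH hint hU hUb hvc huc huv.symm hx
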